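/- Let $K$ be a field and let $A$ be a profinite $K$-algebra, i.e. an inverse limit of a directed inverse system of finite-dimensional $K$-algebras. Then there is a $K$-coalgebra $C$ such that $A\cong C^*$ as $K$-algebras, where $C^*$ is the dual algebra with the convolution product. Moreover, for every $K$-coalgebra $C$ with $A\cong C^*$, the following assertions are equivalent: (i) the Dickson torsion (the largest semiartinian submodule) of every left $A$-module is a direct summand of that module; (ii) the Dickson torsion of every right $A$-module is a direct summand of that module; (iii) $A$ is left semiartinian, i.e. semiartinian as a left $A$-module; (iv) $A$ is right semiartinian, i.e. semiartinian as a right $A$-module; (v) $C_0$ is finite-dimensional and $C$ has finite coradical filtration, i.e. $C_n=C$ for some $n$. In (v), $C_0$ is finite-dimensional if and only if there are only finitely many isomorphism types of simple left $A$-modules, and also if and only if there are only finitely many isomorphism types of simple right $A$-modules; and $C$ has finite coradical filtration if and only if the Jacobson radical $J(A)$ is nilpotent. Here the Loewy series of a module $M$ is given by $L_0(M)=0$, $L_{\alpha+1}(M)/L_\alpha(M)$ is the socle (the sum of all simple submodules) of $M/L_\alpha(M)$, and $L_\alpha(M)=\bigcup_{\beta<\alpha}L_\beta(M)$ for limit ordinals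 $\alpha$; $M$ is semiartinian if $L_\alpha(M)=M$ for some ordinal $\alpha$. The coradical filtration $C_0\subseteq C_1\subseteq\cdots$ of $C$ is given by $C_n=L_{n+1}(C)$, where $C$ is regarded as a left $C^*$-module via $f\cdot x=\sum f(x_2)\,x_1$. -/

import Mathlib

open scoped TensorProduct

noncomputable section

/-! ### Loewy series, semiartinian modules, Dickson torsion

All notions are stated for left modules over a ring `R`; right `A`-modules are, as usual in Mathlib,
left modules over `Aᵐᵒᵖ`. -/

section Semiartinian

universe v w

variable (R : Type v) [Ring R] (M : Type w) [AddCommGroup M] [Module R M]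

/-- The socle of `M`: the sum of all simple submodules. -/
def socle : Submodule R M := sSup {S : Submodule R M | IsSimpleModule R S}

variable {R M} in
/-- The submodule `N'` of `M` containing `N` with `N' / N` the socle of `M / N`. -/
def socleAbove (N : Submodule R M) : Submodule R M := (socle R (M ⧸ N)).comap N.mkQ

/-- The Loewy series of `M`: `L 0 = 0`, `L (α + 1) / L α` is the socle of `M / L α`,
and `L α = ⋃ β < α, L β` at limit ordinals. -/
def loewy (α : Ordinal.{w}) : Submodule R M :=
  Ordinal.limitRecOn α ⊥ (fun _ N => socleAbove N) (fun α _ L => ⨆ (β) (h : β < α), L β h)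

/-- `M` is semiartinian if its Loewy series reaches `M`. -/
def IsSemiartinian : Prop := ∃ α : Ordinal.{w}, loewy R M α = ⊤

/-- The Dickson torsion of `M`: its largest semiartinian submodule, that is, the sum of all
semiartinian submodules. -/
def dicksonTorsion : Submodule R M := sSup {N : Submodule R M | IsSemiartinian R N}

/-- The Dickson torsion of every left `R`-module is a direct summand. -/
def DicksonTorsionSplits : Prop :=
  ∀ (M : Type (max v w)) [AddCommGroup M] [Module R M],
    ∃ X : Submodule R M, IsCompl (dicksonTorsion R M) X

/-- There are only finitely many isomorphism types of simple left `R`-modules. -/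
def FinitelyManySimples : Prop :=
  ∃ (n : ℕ) (S : Fin n → Type (max v w)) (_ : ∀ i, AddCommGroup (S i)) (_ : ∀ i, Module R (S i)),
    ∀ (M : Type (max v w)) [AddCommGroup M] [Module R M], IsSimpleModule R M →
      ∃ i, Nonempty (M ≃ₗ[R] S i)

end Semiartinian

/-! ### Profinite algebras -/

/-- `A` is a profinite `K`-algebra: the inverse limit (with projections `π i`) of an inverse system
`(B i, f)` of finite-dimensional `K`-algebras over a directed index set. -/
def IsProfiniteAlgebra.{x, y, u, v} (K : Type u) (A : Type v) [Field K] [Ring A] [Algebra K A] :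
    Prop :=
  ∃ (ι : Type x) (_ : Preorder ι) (_ : IsDirected ι (· ≤ ·))
    (B : ι → Type y) (_ : ∀ i, Ring (B i)) (_ : ∀ i, Algebra K (B i))
    (_ : ∀ i, FiniteDimensional K (B i))
    (f : ∀ i j : ι, i ≤ j → (B j →ₐ[K] B i)) (π : ∀ i, A →ₐ[K] B i),
    (∀ i, f i i le_rfl = AlgHom.id K (B i)) ∧
    (∀ i j k (hij : i ≤ j) (hjk : j ≤ k), (f i j hij).comp (f j k hjk) = f i k (hij.trans hjk)) ∧
    (∀ i j (hij : i ≤ j), (f i j hij).comp (π j) = π i) ∧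
    ∀ b : ∀ i, B i, (∀ i j (hij : i ≤ j), f i j hij (b j) = b i) → ∃! a : A, ∀ i, π i a = b i

/-! ### Coalgebras: dual algebra and coradical filtration -/

section Coalgebra

variable (K C : Type*) [Field K] [AddCommGroup C] [Module K C] [Coalgebra K C]

/-- The dual algebra `C^*` of a coalgebra, with the convolution product
`(f * g) x = ∑ f x₁ * g x₂` and unit the counit. -/
abbrev DualAlgebra := WithConv (C →ₗ[K] K)

variable {K C}

/-- The left `C^*`-module structure of `C` that comes from `C` as a right comodule over itself:
`f • x = ∑ f x₂ x₁`. -/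
instance DualAlgebra.instSMul : SMul (DualAlgebra K C) C where
  smul f x := TensorProduct.rid K C (f.ofConv.lTensor C (Coalgebra.comul x))

theorem DualAlgebra.smul_def (f : DualAlgebra K C) (x : C) :
    f • x = TensorProduct.rid K C (f.ofConv.lTensor C (Coalgebra.comul x)) := rfl

instance DualAlgebra.instModule : Module (DualAlgebra K C) C where
  one_smul x := by
    have : (1 : DualAlgebra K C).ofConv = Coalgebra.counit := by
      ext; simp [LinearMap.convOne_def]
    rw [smul_def, this]; simp
  mul_smul f g x := by
    have key : ∀ t : C ⊗[K] C,
        TensorProduct.rid K C ((f * g).ofConv.lTensor C t) =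
          TensorProduct.rid K C ((LinearMap.mul' K K ∘ₗ
            TensorProduct.map f.ofConv g.ofConv ∘ₗ Coalgebra.comul).lTensor C t) := fun _ => rfl
    have aux : ∀ t : C ⊗[K] C,
        TensorProduct.rid K C (f.ofConv.lTensor C (Coalgebra.comul
          (TensorProduct.rid K C (g.ofConv.lTensor C t)))) =
        TensorProduct.rid K C ((LinearMap.mul' K K ∘ₗ
          TensorProduct.map f.ofConv g.ofConv).lTensor C
            (TensorProduct.assoc K C C C ((Coalgebra.comul (R := K)).rTensor C t))) := by
      intro t
      induction t with
      | zero => simp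
      | add t₁ t₂ h₁ h₂ => simp only [map_add, h₁, h₂]
      | tmul a b =>
        simp only [LinearMap.lTensor_tmul, LinearMap.rTensor_tmul, TensorProduct.rid_tmul, map_smul]
        induction (Coalgebra.comul (R := K) a) with
        | zero => simp
        | add s₁ s₂ h₁ h₂ => simp only [map_add, smul_add, TensorProduct.add_tmul, h₁, h₂]
        | tmul c d => simp [smul_smul, mul_comm]
    rw [smul_def, smul_def, smul_def, aux, Coalgebra.coassoc_apply, key,
      ← LinearMap.comp_assoc, LinearMap.lTensor_comp_apply]
  smul_zero f := by simp [smul_def]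
  smul_add f x y := by simp [smul_def]
  add_smul f g x := by simp [smul_def, LinearMap.lTensor_add]
  zero_smul x := by simp [smul_def]

instance DualAlgebra.instIsScalarTower : IsScalarTower K (DualAlgebra K C) C where
  smul_assoc k f x := by simp [smul_def, LinearMap.lTensor_smul]

variable (K C)

/-- The coradical filtration `C_0 ⊆ C_1 ⊆ …` of `C`: the Loewy series of `C` as a left
`C^*`-module, numbered so that the coradical `C_0` is the socle. -/
def coradicalFiltration (n : ℕ) : Submodule K C :=
  (loewy (DualAlgebra K C) C (n + 1 : ℕ)).restrictScalars K

end Coalgebra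

end

/-! ### Semiartinian modules and the Dickson torsion -/

section Semiartinian

universe v w w'

variable {R : Type v} [Ring R] {M : Type w} [AddCommGroup M] [Module R M]
  {M' : Type w'} [AddCommGroup M'] [Module R M']

/-! Write `J` for the radical of `A`. Each of the five conditions is equivalent to: `A ⧸ J` is
finite-dimensional and `J` is nilpotent. This condition is invariant under passing to the opposite
ring, so left and right versions agree.

For the existence of `C`, take the functionals on `A` that vanish on the kernel of some projection.
They form a coalgebra, and finite-dimensional duality together with completeness identifies `A` with
its dual.

The link with `C` is formulated for a `RegularPairing`: `A` is the full linear dual of a locally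
finite bimodule `C`. Then `J` consists of the functionals vanishing on the socle `C₀`
(`mem_jacobson_iff`), so `A ⧸ J` is the dual of `C₀`. Moreover `L_n(C)` is the annihilator of `J ^
n` in `C`, so a finite filtration means that `J` is nilpotent.

If `A ⧸ J` is artinian and `J` nilpotent, then `A` is semiartinian, and every module equals its
Dickson torsion. Conversely, suppose that the torsion always splits off. If `A ⧸ J` were
infinite-dimensional, `C` would have infinitely many isotypic components. As every functional on `C`
is an element of `A`, any set of components is cut out by some `e` in `A`. A product `∏ Sᵢ` of
corresponding simple modules must then be all torsion, yet its quotient by `⨁ Sᵢ` has no simple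
submodule (`not_hasSeparatedSimples`). If `J` were not nilpotent, a uniformity property coming from
duality (`jacobsonUniform`) gives products `q_k = b_{k-1} ⋯ b_0` and `r_k = a_0 ⋯ a_{k-1}` of
elements of `J` with `q_k r_k ≠ 0` for all `k`. In a suitable product of modules `A ⧸ J ^ n_k`,
splitting forces the element `(r_k)` to be torsion, but no `q_k` kills it, against the local
transfinite nilpotence of `J` on torsion (`isNilpotent_jacobson`). -/

theorem Submodule.covBy_comap_mkQ_iff {N : Submodule R M} {S : Submodule R (M ⧸ N)} :
    N ⋖ S.comap N.mkQ ↔ IsSimpleModule R S := by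
  rw [isSimpleModule_iff_isAtom, ← (Submodule.comapMkQRelIso N).isAtom_iff, Set.Ici.isAtom_iff]
  rfl

theorem socleAbove_eq (N : Submodule R M) : socleAbove N = N ⊔ sSup {N' | N ⋖ N'} := by
  apply le_antisymm
  · have h : socle R (M ⧸ N) ≤ (N ⊔ sSup {N' | N ⋖ N'}).map N.mkQ := by
      refine sSup_le fun S hS => ?_
      have h1 : N ⋖ S.comap N.mkQ := Submodule.covBy_comap_mkQ_iff.2 hS
      have h2 : S.comap N.mkQ ≤ N ⊔ sSup {N' | N ⋖ N'} := le_sup_of_le_right (le_sSup h1)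
      have h3 := Submodule.map_mono (f := N.mkQ) h2
      rwa [Submodule.map_comap_eq_of_surjective N.mkQ_surjective] at h3
    refine (Submodule.comap_mono h).trans ?_
    rw [Submodule.comap_map_mkQ, ← sup_assoc, sup_idem]
  · refine sup_le ?_ (sSup_le fun N' hN' => ?_)
    · intro x hx
      have : N.mkQ x = 0 := by simpa using hx
      simp [socleAbove, this]
    · have h : (N'.map N.mkQ).comap N.mkQ = N' := by
        rw [Submodule.comap_map_mkQ, sup_eq_right.2 hN'.le]
      have h1 : IsSimpleModule R (N'.map N.mkQ) := by
        rw [← Submodule.covBy_comap_mkQ_iff, h]; exact hN'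
      rw [← h]
      exact Submodule.comap_mono (le_sSup h1)

theorem le_socleAbove (N : Submodule R M) : N ≤ socleAbove N := by
  rw [socleAbove_eq]; exact le_sup_left

theorem CovBy.le_socleAbove {N N' : Submodule R M} (h : N ⋖ N') : N' ≤ socleAbove N := by
  rw [socleAbove_eq]; exact le_sup_of_le_right (le_sSup h)

instance isSemisimpleModule_socle : IsSemisimpleModule R (socle R M) := by
  rw [socle, sSup_eq_iSup]
  exact isSemisimpleModule_biSup_of_isSemisimpleModule_submodule fun S (hS : IsSimpleModule R S) =>
    inferInstance

theorem jacobson_smul_socle {b : R} (hb : b ∈ Ring.jacobson R) {x : M} (hx : x ∈ socle R M) :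
    b • x = 0 := by
  have h := Module.mem_annihilator.1
    (IsSemisimpleModule.jacobson_le_annihilator R (socle R M) hb) ⟨x, hx⟩
  simpa using congrArg Subtype.val h

theorem jacobson_smul_socleAbove {N : Submodule R M} {b : R} (hb : b ∈ Ring.jacobson R) {x : M}
    (hx : x ∈ socleAbove N) : b • x ∈ N := by
  have := jacobson_smul_socle hb (show N.mkQ x ∈ socle R (M ⧸ N) from hx)
  rwa [← map_smul, Submodule.mkQ_apply, Submodule.Quotient.mk_eq_zero] at this

section

variable (R M)

theorem loewy_zero : loewy R M 0 = ⊥ := Ordinal.limitRecOn_zero ..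

theorem loewy_add_one (α : Ordinal.{w}) : loewy R M (α + 1) = socleAbove (loewy R M α) :=
  Ordinal.limitRecOn_add_one ..

theorem loewy_limit {α : Ordinal.{w}} (h : Order.IsSuccLimit α) :
    loewy R M α = ⨆ (β) (_ : β < α), loewy R M β := Ordinal.limitRecOn_limit _ _ _ _ h

theorem loewy_le_add_one (α : Ordinal.{w}) : loewy R M α ≤ loewy R M (α + 1) := by
  rw [loewy_add_one]; exact le_socleAbove _

theorem loewy_mono : Monotone (loewy R M) := by
  intro β α
  induction α using Ordinal.limitRecOn with
  | zero => intro h; rw [nonpos_iff_eq_zero.1 h]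
  | add_one α ih =>
    intro h
    rcases h.lt_or_eq with h | rfl
    · exact (ih (Order.lt_add_one_iff.1 h)).trans (loewy_le_add_one R M α)
    · rfl
  | limit α hα ih =>
    intro h
    rcases h.lt_or_eq with h | rfl
    · rw [loewy_limit R M hα]
      exact le_iSup₂_of_le β h le_rfl
    · rfl

variable {R M} in
theorem mem_loewy_limit {α : Ordinal.{w}} (h : Order.IsSuccLimit α) {x : M} :
    x ∈ loewy R M α ↔ ∃ β < α, x ∈ loewy R M β := by
  rw [loewy_limit R M h, iSup_subtype']
  have : Nonempty {β // β < α} := ⟨⟨0, h.bot_lt⟩⟩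
  rw [Submodule.mem_iSup_of_directed]
  · simp
  · intro a b
    exact ⟨max a b, loewy_mono R M (le_max_left a.1 b.1), loewy_mono R M (le_max_right a.1 b.1)⟩

/-- A module is semiartinian iff each of its nonzero quotients has a simple submodule. -/
theorem isSemiartinian_iff :
    IsSemiartinian R M ↔ ∀ N : Submodule R M, N ≠ ⊤ → ∃ N', N ⋖ N' := by
  constructor
  · rintro ⟨α, hα⟩ N hN
    by_contra! hcov
    have key : ∀ β, loewy R M β ≤ N := by
      intro β
      induction β using Ordinal.limitRecOn with
      | zero => rw [loewy_zero]; exact bot_le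
      | add_one β ih =>
        rw [loewy_add_one, socleAbove_eq]
        refine sup_le ih (sSup_le fun N' hN' => ?_)
        by_contra hle
        -- Modularity: `N'` meets `N` exactly in `loewy R M β`, so the simple factor `N' / loewy R M
        -- β` reappears above `N`.
        refine hcov (N ⊔ N') (covBy_sup_of_inf_covBy_right ?_)
        have h1 : N ⊓ N' = loewy R M β := by
          rcases hN'.eq_or_eq (le_inf ih hN'.le) inf_le_right with h | h
          · exact h
          · exact absurd (inf_eq_right.1 h) hle
        rwa [h1]
      | limit β hβ ih => rw [loewy_limit R M hβ]; exact iSup₂_le ih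
    exact hN (top_le_iff.1 (hα ▸ key α))
  · intro h
    by_contra! hne
    have hne : ∀ α, loewy R M α ≠ ⊤ := fun α hα => hne ⟨α, hα⟩
    have hmono : StrictMono (loewy R M) := by
      intro β α hβα
      obtain ⟨N', hN'⟩ := h _ (hne β)
      refine (hN'.lt.trans_le hN'.le_socleAbove).trans_le ?_
      rw [← loewy_add_one]
      exact loewy_mono R M (Order.add_one_le_of_lt hβα)
    -- A strictly increasing series would embed all of `Ordinal.{w}` into a type in universe `w`.
    exact not_injective_of_ordinal _ hmono.injective

end

theorem IsSemiartinian.of_surjective (h : IsSemiartinian R M) (f : M →ₗ[R] M')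
    (hf : Function.Surjective f) : IsSemiartinian R M' := by
  rw [isSemiartinian_iff] at h ⊢
  intro N hN
  obtain ⟨N', hN'⟩ := h (N.comap f) (fun h => hN (by
    rw [← Submodule.map_comap_eq_of_surjective hf N, h, Submodule.map_top,
      LinearMap.range_eq_top.2 hf]))
  have h1 : (N'.map f).comap f = N' := by
    rw [Submodule.comap_map_eq, sup_eq_left]
    exact (LinearMap.ker_le_comap f).trans hN'.le
  have hs : StrictMono (Submodule.comap f) :=
    Monotone.strictMono_of_injective (fun _ _ => Submodule.comap_mono)
      (Submodule.comap_injective_of_surjective hf)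
  refine ⟨N'.map f, ?_, fun c h2 h3 => ?_⟩
  · have := Submodule.map_mono (f := f) hN'.le
    rw [Submodule.map_comap_eq_of_surjective hf] at this
    refine this.lt_of_ne fun h2 => hN'.lt.ne ?_
    rw [h2, h1]
  · have h3' := hs h3
    rw [h1] at h3'
    exact hN'.2 (hs h2) h3'

theorem LinearEquiv.isSemiartinian_iff (e : M ≃ₗ[R] M') :
    IsSemiartinian R M ↔ IsSemiartinian R M' :=
  ⟨fun h => h.of_surjective e.toLinearMap e.surjective,
    fun h => h.of_surjective e.symm.toLinearMap e.symm.surjective⟩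

theorem IsSemiartinian.of_isSimpleModule [IsSimpleModule R M] : IsSemiartinian R M := by
  rw [_root_.isSemiartinian_iff]
  intro N hN
  refine ⟨⊤, ?_⟩
  rw [(eq_bot_or_eq_top N).resolve_right hN, bot_covBy_iff]
  exact isAtom_top

theorem Submodule.covBy_map_of_injective {f : M →ₗ[R] M'} (hf : Function.Injective f)
    {N N' : Submodule R M} (h : N ⋖ N') : N.map f ⋖ N'.map f := by
  have hs := Submodule.map_strictMono_of_injective hf
  refine ⟨hs h.lt, fun c h1 h2 => ?_⟩
  have h3 : (c.comap f).map f = c := by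
    rw [Submodule.map_comap_eq, inf_eq_right]
    exact h2.le.trans LinearMap.map_le_range
  rw [← h3] at h1 h2
  exact h.2 (lt_of_le_not_ge ((Submodule.map_le_map_iff_of_injective hf _ _).1 h1.le)
      fun h4 => h1.not_ge (Submodule.map_mono h4))
    (lt_of_le_not_ge ((Submodule.map_le_map_iff_of_injective hf _ _).1 h2.le)
      fun h4 => h2.not_ge (Submodule.map_mono h4))

/-- A proper `N` misses some semiartinian `P`, and a simple submodule of `P / (N ∩ P)` embeds into
`M / N`. Hence sums of semiartinian submodules are semiartinian. -/
theorem isSemiartinian_of_dicksonTorsion_eq_top (h : dicksonTorsion R M = ⊤) :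
    IsSemiartinian R M := by
  rw [isSemiartinian_iff]
  intro N hN
  obtain ⟨P, hP, hPN⟩ : ∃ P : Submodule R M, IsSemiartinian R P ∧ ¬ P ≤ N := by
    by_contra! hcon
    exact hN (top_le_iff.1 (h ▸ sSup_le hcon))
  obtain ⟨Q, hQ⟩ := (isSemiartinian_iff R P).1 hP (N.comap P.subtype) (by
    rw [Ne, Submodule.comap_subtype_eq_top]; exact hPN)
  have h1 := Submodule.covBy_map_of_injective P.injective_subtype hQ
  refine ⟨N ⊔ Q.map P.subtype, covBy_sup_of_inf_covBy_right ?_⟩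
  have h2 : N ⊓ Q.map P.subtype = (N.comap P.subtype).map P.subtype := by
    rw [Submodule.map_comap_subtype]
    apply le_antisymm
    · exact le_inf (inf_le_right.trans (Submodule.map_subtype_le P Q)) inf_le_left
    · refine le_inf inf_le_right ?_
      rw [← Submodule.map_comap_subtype]
      exact h1.le
  rwa [h2]

theorem IsSemiartinian.le_dicksonTorsion {N : Submodule R M} (h : IsSemiartinian R N) :
    N ≤ dicksonTorsion R M := le_sSup h

theorem IsSemiartinian.range_le_dicksonTorsion (h : IsSemiartinian R M) (f : M →ₗ[R] M') :
    LinearMap.range f ≤ dicksonTorsion R M' :=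
  (h.of_surjective f.rangeRestrict f.surjective_rangeRestrict).le_dicksonTorsion

variable (M) in
theorem IsSemiartinian.dicksonTorsion_eq_top (h : IsSemiartinian R R) :
    dicksonTorsion R M = ⊤ := by
  refine top_le_iff.1 fun x _ => ?_
  exact h.range_le_dicksonTorsion (LinearMap.toSpanSingleton R M x) ⟨1, by simp⟩

theorem map_dicksonTorsion_le (f : M →ₗ[R] M') :
    (dicksonTorsion R M).map f ≤ dicksonTorsion R M' := by
  rw [Submodule.map_le_iff_le_comap]
  refine sSup_le fun P hP => ?_
  rw [← Submodule.map_le_iff_le_comap, ← Submodule.range_subtype P, ← LinearMap.range_comp]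
  exact IsSemiartinian.range_le_dicksonTorsion hP _

theorem LinearEquiv.map_dicksonTorsion (e : M ≃ₗ[R] M') :
    (dicksonTorsion R M).map (e : M →ₗ[R] M') = dicksonTorsion R M' := by
  refine (map_dicksonTorsion_le _).antisymm fun x hx => ?_
  exact ⟨e.symm x, map_dicksonTorsion_le (e.symm : M' →ₗ[R] M) ⟨x, hx, rfl⟩, by simp⟩

theorem DicksonTorsionSplits.exists_isCompl (h : DicksonTorsionSplits.{v, w} R)
    (M : Type v) [AddCommGroup M] [Module R M] :
    ∃ X : Submodule R M, IsCompl (dicksonTorsion R M) X := by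
  obtain ⟨X, hX⟩ := h (ULift.{w} M)
  let e : ULift.{w} M ≃ₗ[R] M := ULift.moduleEquiv
  refine ⟨X.map (e : ULift.{w} M →ₗ[R] M), ?_⟩
  rw [← e.map_dicksonTorsion]
  exact (Submodule.orderIsoMapComap e).isCompl hX

theorem IsSemiartinian.dicksonTorsionSplits (h : IsSemiartinian R R) :
    DicksonTorsionSplits.{v, w} R := fun M _ _ =>
  ⟨⊥, by rw [h.dicksonTorsion_eq_top M]; exact isCompl_top_bot⟩

/-- The radical acts locally transfinitely nilpotently on the Dickson torsion. -/
theorem exists_smul_eq_zero_of_mem_dicksonTorsion {m : M} (hm : m ∈ dicksonTorsion R M)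
    (q b : ℕ → R) (hb : ∀ k, b k ∈ Ring.jacobson R) (hq : ∀ k, q (k + 1) = b k * q k) :
    ∃ k, q k • m = 0 := by
  -- Quantifying over all sequences makes `T` a submodule: for a scalar `a`, the sequence `q k * a`
  -- obeys the same recursion.
  let T : Submodule R M :=
    { carrier := {m | ∀ q b : ℕ → R, (∀ k, b k ∈ Ring.jacobson R) →
        (∀ k, q (k + 1) = b k * q k) → ∃ k, q k • m = 0}
      zero_mem' := fun q _ _ _ => ⟨0, smul_zero _⟩
      smul_mem' := fun a m hm q b hb hq => by
        simpa only [smul_smul] using hm (fun k => q k * a) b hb fun k => by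
          rw [hq, mul_assoc]
      add_mem' := fun {m n} hm hn q b hb hq => by
        have later : ∀ (x : M) i j, q i • x = 0 → q (i + j) • x = 0 := by
          intro x i j hx
          induction j with
          | zero => exact hx
          | succ j ih => rw [← add_assoc, hq, mul_smul, ih, smul_zero]
        obtain ⟨i, hi⟩ := hm q b hb hq
        obtain ⟨j, hj⟩ := hn q b hb hq
        refine ⟨i + j, ?_⟩
        rw [smul_add, later m i j hi, add_comm i, later n j i hj, add_zero] }
  refine (sSup_le fun N hN => ?_ : dicksonTorsion R M ≤ T) hm q b hb hq
  intro x hx q b hb hq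
  obtain ⟨α, hα⟩ := hN
  have key : ∀ β k, q k • (⟨x, hx⟩ : N) ∈ loewy R N β → ∃ k, q k • x = 0 := by
    intro β
    induction β using Ordinal.limitRecOn with
    | zero =>
      intro k hk
      rw [loewy_zero, Submodule.mem_bot] at hk
      exact ⟨k, by simpa using congrArg Subtype.val hk⟩
    | add_one β ih =>
      intro k hk
      rw [loewy_add_one] at hk
      refine ih (k + 1) ?_
      rw [hq, mul_smul]
      exact jacobson_smul_socleAbove (hb k) hk
    | limit β hβ ih =>
      intro k hk
      obtain ⟨γ, hγ, h⟩ := (mem_loewy_limit hβ).1 hk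
      exact ih γ hγ k h
  exact key α 0 (by rw [hα]; trivial)

/-- A module killed by a power of the radical is semiartinian if the quotient of the ring by its
radical is artinian. -/
theorem isSemiartinian_of_jacobson_pow_smul [IsArtinian R (R ⧸ Ring.jacobson R)] (n : ℕ)
    (h : ∀ a ∈ Ring.jacobson R ^ n, ∀ x : M, a • x = 0) : IsSemiartinian R M := by
  rw [isSemiartinian_iff]
  intro N hN
  have hnt : Nontrivial (M ⧸ N) := Submodule.Quotient.nontrivial_iff.2 hN
  -- The last nonzero `J ^ n (M ⧸ N)` is killed by `J`. Any nonzero `y` in it generates a quotient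
  -- of the artinian module `R ⧸ J`, which contains a simple submodule.
  have key : ∀ n, (∀ a ∈ Ring.jacobson R ^ n, ∀ x : M ⧸ N, a • x = 0) →
      ∃ y : M ⧸ N, y ≠ 0 ∧ ∀ a ∈ Ring.jacobson R, a • y = 0 := by
    intro n
    induction n with
    | zero =>
      intro h
      obtain ⟨x, hx⟩ := exists_ne (0 : M ⧸ N)
      exact absurd (by simpa using h 1 (by rw [Submodule.pow_zero, Ideal.one_eq_top]; trivial) x) hx
    | succ n ih =>
      intro h
      by_cases h' : ∀ a ∈ Ring.jacobson R ^ n, ∀ x : M ⧸ N, a • x = 0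
      · exact ih h'
      · push Not at h'
        obtain ⟨a, ha, x, hx⟩ := h'
        refine ⟨a • x, hx, fun b hb => ?_⟩
        rw [smul_smul]
        refine h _ ?_ x
        rw [Ideal.IsTwoSided.pow_succ]
        exact Ideal.mul_mem_mul hb ha
  obtain ⟨y, hy, hJ⟩ := key n fun a ha x => by
    obtain ⟨x, rfl⟩ := N.mkQ_surjective x
    rw [← map_smul, h a ha, map_zero]
  let f : (R ⧸ Ring.jacobson R) →ₗ[R] M ⧸ N :=
    (Ring.jacobson R).liftQ (LinearMap.toSpanSingleton R _ y) fun a ha => by simpa using hJ a ha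
  have : IsArtinian R (LinearMap.range f) := isArtinian_of_surjective _ f.rangeRestrict
    f.surjective_rangeRestrict
  have hy' : y ∈ LinearMap.range f := ⟨Submodule.Quotient.mk 1, (Submodule.liftQ_apply _ _ _).trans (by simp)⟩
  have : Nontrivial (LinearMap.range f) := ⟨⟨⟨y, hy'⟩, 0, fun h => hy (congrArg Subtype.val h)⟩⟩
  obtain ⟨S, hS⟩ := IsAtomic.exists_atom (Submodule R (LinearMap.range f))
  have h1 := Submodule.covBy_map_of_injective (LinearMap.range f).injective_subtype
    (bot_covBy_iff.2 hS)
  rw [Submodule.map_bot, bot_covBy_iff, ← isSimpleModule_iff_isAtom] at h1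
  exact ⟨_, Submodule.covBy_comap_mkQ_iff.2 h1⟩

end Semiartinian

/-! ### Splitting of the Dickson torsion and the radical -/

section RingTheory

universe v w

variable (A : Type v) [Ring A]

/-- For two-sided linear conditions `y * x * z = 0` on `x`, indexed by a decreasing sequence of sets
of pairs `(y, z)`: if each `x` in the radical satisfies one of them, then one of them holds on all
of the radical. -/
def JacobsonUniform : Prop :=
  ∀ P : ℕ → Set (A × A), Antitone P →
    (∀ x ∈ Ring.jacobson A, ∃ k, ∀ p ∈ P k, p.1 * x * p.2 = 0) →
      ∃ k, ∀ x ∈ Ring.jacobson A, ∀ p ∈ P k, p.1 * x * p.2 = 0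

/-- There is a sequence of simple modules `A ⧸ m i` such that each subset of them is selected by an
element of `A` that acts as the identity on the members and as zero on the others. -/
def HasSeparatedSimples : Prop :=
  ∃ m : ℕ → Ideal A, (∀ i, (m i).IsMaximal) ∧
    ∀ S : Set ℕ, ∃ e : A, ∀ i a, (i ∈ S → e * a - a ∈ m i) ∧ (i ∉ S → e * a ∈ m i)

variable {A}

theorem JacobsonUniform.exists_sequences (hU : JacobsonUniform A)
    (hJ : ¬ IsNilpotent (Ring.jacobson A)) :
    ∃ q r b a : ℕ → A, (∀ k, b k ∈ Ring.jacobson A) ∧ (∀ k, a k ∈ Ring.jacobson A) ∧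
      (∀ k, q (k + 1) = b k * q k) ∧ (∀ k, r (k + 1) = r k * a k) ∧
      ∀ k, q k * r k ≠ 0 := by
  set J := Ring.jacobson A
  -- The invariant carried through the recursion: the product `s.1 * s.2` survives multiplication by
  -- arbitrarily high powers of `J` on both sides.
  let Inv : A × A → Prop := fun s => ∀ n, ∃ y ∈ J ^ n, ∃ z ∈ J ^ n, y * (s.1 * s.2) * z ≠ 0
  have hanti : ∀ {k l : ℕ}, k ≤ l → J ^ l ≤ J ^ k := fun h => Ideal.pow_le_pow_right h
  have base : Inv (1, 1) := by
    intro n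
    by_contra! h
    refine hJ ⟨n + n, ?_⟩
    rw [Ideal.IsTwoSided.pow_add, Ideal.zero_eq_bot, eq_bot_iff, Ideal.mul_le]
    intro y hy z hz
    simpa using h y hy z hz
  have left : ∀ s, Inv s → ∃ b ∈ J, Inv (b * s.1, s.2) := by
    intro s hs
    by_contra! h
    -- If no `b` in `J` works, each `b` fails at its own exponent. Uniformity gives one `k` for all
    -- `b`, so `J ^ k * J` kills `s.1 * s.2 * J ^ k`, contradicting the invariant at `k + 1`.
    obtain ⟨k, hk⟩ := hU (fun n => {p | p.1 ∈ J ^ n ∧ ∃ z ∈ J ^ n, p.2 = s.1 * s.2 * z})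
      (fun k l hkl p ⟨h1, z, hz, h2⟩ => ⟨hanti hkl h1, z, hanti hkl hz, h2⟩) (by
        intro x hx
        have := h x hx
        simp only [Inv, not_forall] at this
        obtain ⟨n, hn⟩ := this
        push Not at hn
        refine ⟨n, ?_⟩
        rintro ⟨y, _⟩ ⟨hy, z, hz, rfl⟩
        simpa only [mul_assoc] using hn y hy z hz)
    obtain ⟨y, hy, z, hz, hne⟩ := hs (k + 1)
    refine hne ?_
    rw [Submodule.pow_succ] at hy
    clear hne
    induction hy using Submodule.mul_induction_on' with
    | mem_mul_mem y hy x hx =>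
      simpa only [mul_assoc] using hk x hx (y, s.1 * s.2 * z) ⟨hy, z, hanti (Nat.le_succ k) hz, rfl⟩
    | add y _ y' _ h1 h2 => rw [add_mul, add_mul, h1, h2, add_zero]
  have right : ∀ s, Inv s → ∃ a ∈ J, Inv (s.1, s.2 * a) := by
    intro s hs
    by_contra! h
    obtain ⟨k, hk⟩ := hU (fun n => {p | p.2 ∈ J ^ n ∧ ∃ y ∈ J ^ n, p.1 = y * (s.1 * s.2)})
      (fun k l hkl p ⟨h1, z, hz, h2⟩ => ⟨hanti hkl h1, z, hanti hkl hz, h2⟩) (by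
        intro x hx
        have := h x hx
        simp only [Inv, not_forall] at this
        obtain ⟨n, hn⟩ := this
        push Not at hn
        refine ⟨n, ?_⟩
        rintro ⟨_, z⟩ ⟨hz, y, hy, rfl⟩
        simpa only [mul_assoc] using hn y hy z hz)
    obtain ⟨y, hy, z, hz, hne⟩ := hs (k + 1)
    refine hne ?_
    rw [Ideal.IsTwoSided.pow_succ] at hz
    clear hne
    induction hz using Submodule.mul_induction_on' with
    | mem_mul_mem x hx z hz =>
      simpa only [mul_assoc] using hk x hx (y * (s.1 * s.2), z) ⟨hz, y, hanti (Nat.le_succ k) hy, rfl⟩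
    | add y _ y' _ h1 h2 => rw [mul_add, h1, h2, add_zero]
  choose! b hbJ hbI using left
  choose! a haJ haI using right
  let step : A × A → A × A := fun s => (b s * s.1, s.2 * a (b s * s.1, s.2))
  let s : ℕ → A × A := fun k => step^[k] (1, 1)
  have hs : ∀ k, s (k + 1) = step (s k) := fun k => Function.iterate_succ_apply' ..
  have hinv : ∀ k, Inv (s k) := by
    intro k
    induction k with
    | zero => exact base
    | succ k ih => rw [hs]; exact haI _ (hbI _ ih)
  refine ⟨fun k => (s k).1, fun k => (s k).2, fun k => b (s k), fun k => a (b (s k) * (s k).1, (s k).2),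
    fun k => hbJ _ (hinv k), fun k => haJ _ (hbI _ (hinv k)), fun k => by simp only [hs, step],
    fun k => by simp only [hs, step], fun k h => ?_⟩
  obtain ⟨y, -, z, -, h'⟩ := hinv k 0
  exact h' (by rw [h, mul_zero, zero_mul])

theorem isSemiartinian_of_isNilpotent_jacobson [IsArtinian A (A ⧸ Ring.jacobson A)]
    (h : IsNilpotent (Ring.jacobson A)) : IsSemiartinian A A := by
  obtain ⟨n, hn⟩ := h
  refine isSemiartinian_of_jacobson_pow_smul n fun a ha x => ?_
  rw [hn] at ha
  rw [(Submodule.mem_bot A).1 ha, zero_smul]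

/-- Splitting is applied to `∏ A ⧸ J ^ n k`, with `n k` so large that `q k * r k` is nonzero in the
`k`-th factor. Modulo torsion, `m = (r k)` is divisible by every `r N`, which kills the factors of
exponent at most `N`; so the component of `m` in the complement vanishes. -/
theorem DicksonTorsionSplits.isNilpotent_jacobson (h : DicksonTorsionSplits.{v, w} A)
    [IsArtinian A (A ⧸ Ring.jacobson A)] (hU : JacobsonUniform A)
    (hsep : ∀ a : A, (∀ n, a ∈ Ring.jacobson A ^ n) → a = 0) :
    IsNilpotent (Ring.jacobson A) := by
  by_contra hJ
  obtain ⟨q, r, b, a, hb, ha, hq, hr, hne⟩ := hU.exists_sequences hJ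
  set J := Ring.jacobson A
  have hr' : ∀ k j, ∃ s, r (k + j) = r k * s := by
    intro k j
    induction j with
    | zero => exact ⟨1, by simp⟩
    | succ j ih =>
      obtain ⟨s, hs⟩ := ih
      exact ⟨s * a (k + j), by rw [← add_assoc, hr, hs, mul_assoc]⟩
  have hrJ : ∀ k, r k ∈ J ^ k := by
    intro k
    induction k with
    | zero => rw [Submodule.pow_zero, Ideal.one_eq_top]; trivial
    | succ k ih => rw [hr, Submodule.pow_succ]; exact Ideal.mul_mem_mul ih (ha k)
  have hn : ∀ k, ∃ n, q k * r k ∉ J ^ n := fun k => by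
    by_contra! h; exact hne k (hsep _ h)
  choose n hn using hn
  have hkill : ∀ n, ∀ x ∈ J ^ n, ∀ y : A ⧸ J ^ n, x • y = 0 := by
    intro n x hx y
    obtain ⟨y, rfl⟩ := Submodule.Quotient.mk_surjective _ y
    rw [← Submodule.Quotient.mk_smul, Submodule.Quotient.mk_eq_zero]
    exact Ideal.mul_mem_right _ _ hx
  let M := ∀ k, A ⧸ J ^ n k
  obtain ⟨X, hX⟩ := h.exists_isCompl M
  have hmem : ∀ x : M, x ∈ dicksonTorsion A M ⊔ X := fun x => by rw [hX.sup_eq_top]; trivial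
  let m : M := fun k => Submodule.Quotient.mk (r k)
  have hsingle : ∀ k (x : A ⧸ J ^ n k), (Pi.single k x : M) ∈ dicksonTorsion A M := fun k x =>
    (isSemiartinian_of_jacobson_pow_smul (n k) (hkill (n k))).range_le_dicksonTorsion
      (LinearMap.single A (fun k => A ⧸ J ^ n k) k) ⟨x, rfl⟩
  obtain ⟨t, ht, f, hf, htf⟩ := Submodule.mem_sup.1 (hmem m)
  have hf0 : f = 0 := by
    funext l
    set N := n l
    let t' : M := ∑ k ∈ Finset.range N, Pi.single k (m k)
    have ht' : t' ∈ dicksonTorsion A M := Submodule.sum_mem _ fun k _ => hsingle k _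
    choose s hs using fun j => hr' N j
    -- Beyond the first `N` coordinates, `m` is `r N` times `m'`. The remaining finitely many
    -- coordinates `t'` are torsion.
    let m' : M := fun k => if N ≤ k then Submodule.Quotient.mk (s (k - N)) else 0
    have hm : m = r N • m' + t' := by
      funext k
      have h1 : t' k = if k < N then m k else 0 :=
        (Finset.sum_apply k _ _).trans ((Finset.sum_pi_single k _ _).trans (by simp))
      rw [Pi.add_apply, Pi.smul_apply, h1]
      by_cases hk : N ≤ k
      · simp only [m', m, if_pos hk, if_neg hk.not_gt, add_zero, ← Submodule.Quotient.mk_smul,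
          smul_eq_mul, ← hs, Nat.add_sub_cancel' hk]
      · simp only [m', if_neg hk, if_pos (not_le.1 hk), smul_zero, zero_add]
    obtain ⟨t'', ht'', f'', hf'', htf''⟩ := Submodule.mem_sup.1 (hmem m')
    have h2 : f - r N • f'' = r N • t'' + t' - t := by
      have : t + f = r N • (t'' + f'') + t' := by rw [htf, htf'', hm]
      rw [smul_add] at this
      rw [eq_sub_of_add_eq' this]; abel
    have h3 : f - r N • f'' = 0 := by
      refine (Submodule.disjoint_def.1 hX.disjoint) _ ?_ (X.sub_mem hf (X.smul_mem _ hf''))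
      rw [h2]
      exact Submodule.sub_mem _ (Submodule.add_mem _ (Submodule.smul_mem _ _ ht'') ht') ht
    rw [sub_eq_zero.1 h3]
    exact hkill N _ (hrJ N) _
  rw [hf0, add_zero] at htf
  obtain ⟨k, hk⟩ := exists_smul_eq_zero_of_mem_dicksonTorsion (htf ▸ ht) q b hb hq
  have : q k • (Submodule.Quotient.mk (r k) : A ⧸ J ^ n k) = 0 := congrFun hk k
  rw [← Submodule.Quotient.mk_smul, Submodule.Quotient.mk_eq_zero] at this
  exact hn k this

theorem DicksonTorsionSplits.not_hasSeparatedSimples (h : DicksonTorsionSplits.{v, w} A) :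
    ¬ HasSeparatedSimples A := by
  rintro ⟨m, hm, hS⟩
  let M := ∀ i, A ⧸ m i
  have hsimple : ∀ i, IsSimpleModule A (A ⧸ m i) := fun i => isSimpleModule_iff_isCoatom.2 (hm i).out
  choose e he using hS
  have he1 : ∀ S, ∀ i ∈ S, ∀ x : A ⧸ m i, e S • x = x := by
    intro S i hi x
    obtain ⟨x, rfl⟩ := Submodule.Quotient.mk_surjective _ x
    rw [← Submodule.Quotient.mk_smul, Submodule.Quotient.eq]
    exact (he S i x).1 hi
  have he0 : ∀ S, ∀ i ∉ S, ∀ x : A ⧸ m i, e S • x = 0 := by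
    intro S i hi x
    obtain ⟨x, rfl⟩ := Submodule.Quotient.mk_surjective _ x
    rw [← Submodule.Quotient.mk_smul, Submodule.Quotient.mk_eq_zero]
    exact (he S i x).2 hi
  obtain ⟨X, hX⟩ := h.exists_isCompl M
  -- The separating element of `{i}` projects `X` to the `i`-th coordinate without leaving `X`; but
  -- the single factors are torsion.
  have hX0 : X = ⊥ := by
    rw [eq_bot_iff]
    intro f hf
    refine (Submodule.mem_bot A).2 (funext fun i => ?_)
    have h1 : e {i} • f = Pi.single i (f i) := by
      funext j
      by_cases hj : j = i
      · subst hj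
        rw [Pi.single_eq_same, Pi.smul_apply, he1 {j} j rfl]
      · rw [Pi.single_eq_of_ne hj, Pi.smul_apply, he0 {i} j hj]
    have h2 : (Pi.single i (f i) : M) ∈ dicksonTorsion A M :=
      (IsSemiartinian.of_isSimpleModule (R := A)).range_le_dicksonTorsion
        (LinearMap.single A (fun i => A ⧸ m i) i) ⟨f i, rfl⟩
    have h3 := Submodule.disjoint_def.1 hX.disjoint _ h2 (h1 ▸ X.smul_mem _ hf)
    simpa using congrFun h3 i
  have hsemi : IsSemiartinian A M := isSemiartinian_of_dicksonTorsion_eq_top (by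
    have := hX.sup_eq_top; rwa [hX0, sup_bot_eq] at this)
  let N : Submodule A M :=
    { carrier := {f | {i | f i ≠ 0}.Finite}
      zero_mem' := Set.finite_empty.subset fun i hi => hi rfl
      add_mem' := fun {f g} hf hg => (hf.union hg).subset fun i hi => by
        by_contra hcon
        simp only [Set.mem_union, Set.mem_ofPred_eq, not_or, not_not] at hcon
        exact hi (by rw [Pi.add_apply, hcon.1, hcon.2, add_zero])
      smul_mem' := fun a f hf => hf.subset fun i hi h0 => hi (by
        rw [Pi.smul_apply, h0, smul_zero]) }
  have hNtop : N ≠ ⊤ := by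
    intro htop
    have h1 : (fun i => Submodule.Quotient.mk 1 : M) ∈ N := htop ▸ trivial
    refine Set.infinite_univ (h1.subset fun i _ => ?_)
    rw [Set.mem_ofPred_eq, Ne, Submodule.Quotient.mk_eq_zero]
    exact fun h => (hm i).ne_top ((Ideal.eq_top_iff_one _).2 h)
  obtain ⟨N', hN'⟩ := (isSemiartinian_iff A M).1 hsemi N hNtop
  obtain ⟨x, hx, hxN⟩ := SetLike.exists_of_lt hN'.lt
  -- Cut the support of `x` into two infinite halves. The half `e S • x` already generates `N' / N`;
  -- then the other half must lie in `N`, although its support is infinite.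
  obtain ⟨S, S', hSS, hdisj, hcard⟩ :=
    (show {i | x i ≠ 0}.Infinite from hxN).exists_union_disjoint_cardinal_eq_of_infinite
  have hinf : S.Infinite ∧ S'.Infinite := by
    have hiff : S.Infinite ↔ S'.Infinite := by
      rw [← Set.infinite_coe_iff, ← Set.infinite_coe_iff, Cardinal.infinite_iff,
        Cardinal.infinite_iff, hcard]
    have : (S ∪ S').Infinite := hSS ▸ hxN
    rw [Set.infinite_union, ← hiff, or_self] at this
    exact ⟨this, hiff.1 this⟩
  have hex : e S • x ∉ N := fun hmem => hinf.1 (hmem.subset fun i hi => by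
    have : x i ≠ 0 := (hSS ▸ Set.mem_union_left S' hi : i ∈ {i | x i ≠ 0})
    rwa [Set.mem_ofPred_eq, Pi.smul_apply, he1 _ _ hi])
  have hsup : N ⊔ Submodule.span A {e S • x} = N' := by
    refine (hN'.eq_or_eq le_sup_left (sup_le hN'.le ?_)).resolve_left fun h => hex ?_
    · rw [Submodule.span_singleton_le_iff_mem]; exact N'.smul_mem _ hx
    · rw [← h]; exact Submodule.mem_sup_right (Submodule.mem_span_singleton_self _)
  rw [← hsup] at hx
  obtain ⟨y, hy, z, hz, hyz⟩ := Submodule.mem_sup.1 hx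
  obtain ⟨a, rfl⟩ := Submodule.mem_span_singleton.1 hz
  -- Here `x = y + a • e S • x`, and `1 - e S` annihilates the last term.
  have h1 : x - e S • x = y - e S • y := by
    have h2 : a • e S • x - e S • a • e S • x = 0 := by
      funext i
      change a • e S • x i - e S • a • e S • x i = 0
      by_cases hi : i ∈ S
      · rw [he1 _ _ hi (a • _), sub_self]
      · rw [he0 _ _ hi (x i), smul_zero, smul_zero, sub_zero]
    nth_rw 1 [← hyz]
    nth_rw 2 [← hyz]
    rw [smul_add, add_sub_add_comm, h2, add_zero]
  have h2 : x - e S • x ∈ N := h1 ▸ N.sub_mem hy (N.smul_mem _ hy)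
  refine hinf.2 (Set.Finite.subset h2 fun i hi => ?_)
  have h3 : x i ≠ 0 := (hSS ▸ Set.mem_union_right S hi : i ∈ {i | x i ≠ 0})
  rw [Set.mem_ofPred_eq, Pi.sub_apply, Pi.smul_apply, he0 _ _ (Set.disjoint_right.1 hdisj hi), sub_zero]
  exact h3

/-- The separating element of `{i}` is the identity on `A ⧸ m i` and zero on every other `A ⧸ m i'`,
so these modules are pairwise nonisomorphic; pigeonhole finishes. -/
theorem FinitelyManySimples.not_hasSeparatedSimples (h : FinitelyManySimples.{v, w} A) :
    ¬ HasSeparatedSimples A := by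
  rintro ⟨m, hm, hS⟩
  obtain ⟨n, S, _, _, h⟩ := h
  have hsimple : ∀ i, IsSimpleModule A (A ⧸ m i) := fun i => isSimpleModule_iff_isCoatom.2 (hm i).out
  have h1 : ∀ i, ∃ j, Nonempty ((A ⧸ m i) ≃ₗ[A] S j) := fun i => by
    obtain ⟨j, ⟨f⟩⟩ := h (ULift.{w} (A ⧸ m i)) (IsSimpleModule.congr ULift.moduleEquiv)
    exact ⟨j, ⟨ULift.moduleEquiv.symm.trans f⟩⟩
  choose j hj using h1
  obtain ⟨i, i', hne, heq⟩ := Finite.exists_ne_map_eq_of_infinite j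
  obtain ⟨f⟩ := hj i
  obtain ⟨f'⟩ := hj i'
  rw [← heq] at f'
  let g := f.trans f'.symm
  obtain ⟨e, he⟩ := hS {i}
  have h2 : e • g (Submodule.Quotient.mk 1) = 0 := by
    obtain ⟨x, hx⟩ := Submodule.Quotient.mk_surjective _ (g (Submodule.Quotient.mk 1))
    rw [← hx, ← Submodule.Quotient.mk_smul, Submodule.Quotient.mk_eq_zero]
    exact (he i' x).2 (Ne.symm hne)
  rw [← map_smul, EmbeddingLike.map_eq_zero_iff, ← Submodule.Quotient.mk_smul,
    Submodule.Quotient.mk_eq_zero] at h2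
  have h3 := (m i).sub_mem h2 ((he i 1).1 rfl)
  rw [smul_eq_mul, sub_sub_cancel] at h3
  exact (hm i).ne_top ((Ideal.eq_top_iff_one _).2 h3)

/-- `A ⧸ J` is semisimple of finite length and has finitely many isotypic components. Every simple
module is a quotient, hence a summand, of it. -/
theorem finitelyManySimples_of_isArtinian [IsArtinian A (A ⧸ Ring.jacobson A)] :
    FinitelyManySimples.{v, w} A := by
  have hss : IsSemisimpleModule A (A ⧸ Ring.jacobson A) :=
    (IsArtinian.isSemisimpleModule_iff_jacobson _ _).2 (Module.jacobson_quotient_jacobson A A)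
  let B := A ⧸ Ring.jacobson A
  have hnoeth : IsNoetherian A B := ((IsSemisimpleModule.finite_tfae (R := A) (M := B)).out 1 2).2 ‹_›
  obtain ⟨n, ⟨φ⟩⟩ := Finite.exists_equiv_fin (isotypicComponents A B)
  have hrep : ∀ c : isotypicComponents A B, ∃ S : Submodule A B, IsSimpleModule A S ∧
      c.1 = isotypicComponent A B S := fun c => c.2
  choose S hSs hS using hrep
  refine ⟨n, fun i => ULift.{w} (S (φ.symm i)), fun _ => inferInstance, fun _ => inferInstance, ?_⟩
  intro M _ _ hM
  obtain ⟨I, hI, ⟨f⟩⟩ := isSimpleModule_iff_quot_maximal.1 hM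
  let g : B →ₗ[A] A ⧸ I := Submodule.factor (Ring.jacobson_le_of_isMaximal I)
  have hg : Function.Surjective g := Submodule.factor_surjective _
  obtain ⟨P, ⟨p⟩⟩ := IsSemisimpleModule.exists_submodule_linearEquiv_quotient (LinearMap.ker g)
  let p' : P ≃ₗ[A] M := p.trans ((g.quotKerEquivOfSurjective hg).trans f.symm)
  have hP : IsSimpleModule A P := IsSimpleModule.congr p'
  let c : isotypicComponents A B := ⟨isotypicComponent A B P, P, hP, rfl⟩
  have hle : P ≤ isotypicComponent A B (S c) := by
    rw [← hS c]; exact P.le_isotypicComponent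
  have hSc := hSs c
  obtain ⟨u⟩ := isIsotypicOfType_submodule_iff.1 (IsIsotypicOfType.isotypicComponent A B (S c)) P hle
  exact ⟨φ c, ⟨p'.symm.trans (u.trans ((LinearEquiv.ofEq _ _ (by simp)).trans
    ULift.moduleEquiv.symm))⟩⟩

end RingTheory

/-! ### Algebras paired with a bimodule as the dual of a coalgebra -/

/-! ### Functionals that detect a decreasing sequence of subspaces -/

section LinearAlgebra

variable {K V : Type*} [Field K] [AddCommGroup V] [Module K V]

/-- If the intersection is nonzero, detect one of its vectors. Otherwise choose nonzero vectors,
each outside the subspace containing the later ones; they are independent, and `ψ` can be `1` on all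
of them. -/
theorem exists_dual_ne_zero_of_antitone {W : ℕ → Submodule K V} (hW : Antitone W)
    (hne : ∀ k, W k ≠ ⊥) : ∃ ψ : V →ₗ[K] K, ∀ k, ∃ w ∈ W k, ψ w ≠ 0 := by
  by_cases hinf : (⨅ k, W k) = ⊥
  · choose d hd hd0 using fun k => Submodule.exists_mem_ne_zero_of_ne_bot (hne k)
    have hex : ∀ k, ∃ l, d k ∉ W l := by
      intro k
      by_contra! h
      have h1 : d k ∈ ⨅ k, W k := (Submodule.mem_iInf _).2 h
      rw [hinf] at h1
      exact hd0 k ((Submodule.mem_bot K).1 h1)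
    choose l hl using hex
    have hlt : ∀ k, k < l k := fun k => by
      by_contra! h; exact hl k (hW h (hd k))
    let n : ℕ → ℕ := fun i => l^[i] 0
    have hn : ∀ i, n (i + 1) = l (n i) := fun i => Function.iterate_succ_apply' ..
    have hmono : StrictMono n := strictMono_nat_of_lt_succ fun i => by rw [hn]; exact hlt _
    have hli : LinearIndependent K fun i => d (n i) := by
      rw [linearIndependent_iff']
      intro s g hg i
      induction i using Nat.strong_induction_on with
      | _ i ih =>
        intro hi
        by_contra hgi
        have h1 : g i • d (n i) = - ∑ j ∈ s.erase i, g j • d (n j) := by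
          rw [← Finset.add_sum_erase s _ hi] at hg
          exact eq_neg_of_add_eq_zero_left hg
        have h2 : g i • d (n i) ∈ W (n (i + 1)) := by
          rw [h1]
          refine neg_mem (Submodule.sum_mem _ fun j hj => ?_)
          rcases lt_trichotomy j i with h | h | h
          · rw [ih j h (Finset.mem_of_mem_erase hj), zero_smul]; exact zero_mem _
          · exact absurd h (Finset.ne_of_mem_erase hj)
          · exact Submodule.smul_mem _ _ (hW (hmono.monotone h) (hd _))
        rw [hn, Submodule.smul_mem_iff _ hgi] at h2
        exact hl _ h2
    obtain ⟨ψ, hψ⟩ := LinearMap.exists_extend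
      ((Module.Basis.span hli).constr K fun _ => (1 : K))
    refine ⟨ψ, fun k => ⟨d (n k), hW (hmono.id_le k) (hd _), ?_⟩⟩
    have h1 : ψ (d (n k)) = 1 := by
      have h2 := (Module.Basis.span hli).constr_basis K (fun _ => (1 : K)) k
      rw [← hψ, LinearMap.comp_apply, Submodule.subtype_apply, Module.Basis.span_apply] at h2
      exact h2
    rw [h1]; exact one_ne_zero
  · obtain ⟨d, hd, hd0⟩ := Submodule.exists_mem_ne_zero_of_ne_bot hinf
    obtain ⟨ψ, hψ⟩ : ∃ ψ : V →ₗ[K] K, ψ d ≠ 0 := by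
      by_contra! h; exact hd0 ((Module.forall_dual_apply_eq_zero_iff K d).1 h)
    exact ⟨ψ, fun k => ⟨d, (Submodule.mem_iInf _).1 hd k, hψ⟩⟩

theorem exists_dual_ne_zero_of_antitone_of_not_le {W : ℕ → Submodule K V} (hW : Antitone W)
    (U : Submodule K V) (hne : ∀ k, ¬ W k ≤ U) :
    ∃ ψ : V →ₗ[K] K, (∀ u ∈ U, ψ u = 0) ∧ ∀ k, ∃ w ∈ W k, ψ w ≠ 0 := by
  obtain ⟨ψ, hψ⟩ := exists_dual_ne_zero_of_antitone (W := fun k => (W k).map U.mkQ)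
    (fun k l h => Submodule.map_mono (hW h)) (fun k h => hne k (by
      rw [← Submodule.ker_mkQ U]; exact LinearMap.le_ker_iff_map.2 h))
  refine ⟨ψ ∘ₗ U.mkQ, fun u hu => ?_, fun k => ?_⟩
  · exact (congrArg ψ ((Submodule.Quotient.mk_eq_zero U).2 hu)).trans (map_zero ψ)
  · obtain ⟨_, ⟨w, hw, rfl⟩, h⟩ := hψ k
    exact ⟨w, hw, h⟩

theorem exists_dual_eq_zero_ne_zero {N : Submodule K V} {x : V} (hx : x ∉ N) :
    ∃ ψ : V →ₗ[K] K, (∀ u ∈ N, ψ u = 0) ∧ ψ x ≠ 0 := by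
  obtain ⟨ψ, h1, h2⟩ := Submodule.exists_le_ker_of_notMem hx
  exact ⟨ψ, fun u hu => LinearMap.mem_ker.1 (h2 hu), h1⟩

end LinearAlgebra

section Socle

variable {R M M' : Type*} [Ring R] [AddCommGroup M] [Module R M] [AddCommGroup M'] [Module R M']

theorem Submodule.le_socle (N : Submodule R M) [IsSemisimpleModule R N] : N ≤ socle R M := by
  rw [← Submodule.map_subtype_top N, ← IsSemisimpleModule.sSup_simples_eq_top R N,
    Submodule.map_le_iff_le_comap]
  refine sSup_le fun S (hS : IsSimpleModule R S) => ?_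
  rw [← Submodule.map_le_iff_le_comap]
  refine le_sSup ?_
  rw [isSimpleModule_iff_isAtom, ← bot_covBy_iff] at hS
  have := Submodule.covBy_map_of_injective N.injective_subtype hS
  rwa [Submodule.map_bot, bot_covBy_iff, ← isSimpleModule_iff_isAtom] at this

theorem map_socle_le (f : M →ₗ[R] M') : (socle R M).map f ≤ socle R M' := by
  rw [← Submodule.range_subtype (socle R M), ← LinearMap.range_comp]
  have := IsSemisimpleModule.range (f ∘ₗ (socle R M).subtype)
  exact Submodule.le_socle _

end Socle

/-- The data of an identification of the algebra `A` with the dual of a bimodule `C` which is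
locally finite as a left module, where `f ↦ f 1` is the evaluation at the counit: this is what the
identification of `A` with the dual algebra of a coalgebra `C` amounts to. -/
structure RegularPairing (K A C : Type*) [Field K] [Ring A] [Algebra K A] [AddCommGroup C]
    [Module K C] [Module A C] [IsScalarTower K A C] where
  /-- The evaluation of elements of `A` on `C`. -/
  ev : A ≃ₗ[K] (C →ₗ[K] K)
  /-- The right action of `A` on `C`. -/
  ract : A → C →ₗ[A] C
  ev_smul : ∀ f g x, ev f (g • x) = ev (f * g) x
  ev_ract : ∀ f g x, ev g (ract f x) = ev (f * g) x
  exists_finiteDimensional : ∀ x : C, ∃ W : Submodule K C, FiniteDimensional K W ∧ ∀ a : A, a • x ∈ W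

namespace RegularPairing

variable {K A C : Type*} [Field K] [Ring A] [Algebra K A] [AddCommGroup C]
    [Module K C] [Module A C] [IsScalarTower K A C] (P : RegularPairing K A C)

include P

theorem ext_dual {x y : C} (h : ∀ f : A, P.ev f x = P.ev f y) : x = y := by
  rw [← sub_eq_zero, ← Module.forall_dual_apply_eq_zero_iff K]
  intro φ
  obtain ⟨f, rfl⟩ := P.ev.surjective φ
  rw [map_sub, h, sub_self]

theorem ev_eq_one_smul (f : A) (x : C) : P.ev f x = P.ev 1 (f • x) := by
  rw [P.ev_smul, one_mul]

theorem ext_left {f g : A} (h : ∀ x, P.ev f x = P.ev g x) : f = g :=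
  P.ev.injective (LinearMap.ext h)

theorem exists_ev_ne_zero {N : Submodule A C} {x : C} (hx : x ∉ N) :
    ∃ φ : A, (∀ u ∈ N, P.ev φ u = 0) ∧ P.ev φ x ≠ 0 := by
  obtain ⟨ψ, h1, h2⟩ := exists_dual_eq_zero_ne_zero (N := N.restrictScalars K) hx
  exact ⟨P.ev.symm ψ, by simpa using h1, by simpa using h2⟩

/-- The right action of an element vanishing on `N` factors through `C ⧸ N`. -/
theorem ract_apply_eq_zero {N : Submodule A C} {φ : A} (hφ : ∀ u ∈ N, P.ev φ u = 0) {x : C}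
    (hx : x ∈ N) : P.ract φ x = 0 := by
  refine P.ext_dual fun g => ?_
  rw [P.ev_ract, ← P.ev_smul, hφ _ (N.smul_mem _ hx), map_zero]

theorem ract_mem_socle {f : A} {x : C} (hx : x ∈ socle A C) : P.ract f x ∈ socle A C :=
  map_socle_le _ ⟨x, hx, rfl⟩

theorem smul_eq_zero_of_ev_eq_zero {f : A} (hf : ∀ x ∈ socle A C, P.ev f x = 0) {x : C}
    (hx : x ∈ socle A C) : f • x = 0 := by
  refine P.ext_dual fun g => ?_
  rw [P.ev_smul, ← P.ev_ract, hf _ (P.ract_mem_socle hx), map_zero]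

/-- A functional `φ` separating `f • x` from `N` turns the right action into an `A`-linear map `C ⧸
N → C`. It sends socle to socle, where `f` acts as zero. -/
theorem smul_mem_of_mem_socleAbove {f : A} (hf : ∀ x ∈ socle A C, P.ev f x = 0)
    {N : Submodule A C} {x : C} (hx : x ∈ socleAbove N) : f • x ∈ N := by
  by_contra hcon
  obtain ⟨φ, hφ, hne⟩ := P.exists_ev_ne_zero hcon
  refine hne ?_
  let θ : (C ⧸ N) →ₗ[A] C := N.liftQ (P.ract φ) fun u hu => P.ract_apply_eq_zero hφ hu
  have h1 : P.ract φ x ∈ socle A C := map_socle_le θ ⟨N.mkQ x, hx, rfl⟩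
  have h2 : P.ract φ (f • x) = 0 := by rw [map_smul, P.smul_eq_zero_of_ev_eq_zero hf h1]
  rw [← mul_one φ, ← P.ev_ract, h2, map_zero]

/-! ### Local finiteness and the radical -/

theorem finiteDimensional_span_singleton (x : C) :
    FiniteDimensional K ((Submodule.span A {x}).restrictScalars K) := by
  obtain ⟨W, hW, h⟩ := P.exists_finiteDimensional x
  refine Submodule.finiteDimensional_of_le (S₂ := W) fun y hy => ?_
  obtain ⟨a, rfl⟩ := Submodule.mem_span_singleton.1 hy
  exact h a

/-- `A • x` is finite-dimensional, so the Loewy series stabilises on it; it cannot stop early, as a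
cover of the stable term would enter the next step. -/
theorem exists_mem_loewy (x : C) : ∃ n : ℕ, x ∈ loewy A C n := by
  set N := Submodule.span A {x}
  have hfd : FiniteDimensional K N := P.finiteDimensional_span_singleton x
  have hart : IsArtinian A N := isArtinian_of_tower K inferInstance
  have hnoeth : IsNoetherian A N := isNoetherian_of_tower K inferInstance
  let L : ℕ →o Submodule A N :=
    ⟨fun n => (loewy A C n).comap N.subtype, fun i j h =>
      Submodule.comap_mono (loewy_mono A C (by exact_mod_cast h))⟩
  obtain ⟨n, hn⟩ := monotone_stabilizes_iff_noetherian.2 hnoeth L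
  refine ⟨n, ?_⟩
  suffices h : L n = ⊤ from
    Submodule.comap_subtype_eq_top.1 h (Submodule.mem_span_singleton_self x)
  by_contra hne
  obtain ⟨Q, hQ, -⟩ := exists_covBy_le_of_lt (lt_top_iff_ne_top.2 hne)
  have h1 := Submodule.covBy_map_of_injective N.injective_subtype hQ
  have h2 : (L n).map N.subtype = loewy A C n ⊓ Q.map N.subtype := by
    apply le_antisymm
    · exact le_inf (Submodule.map_comap_le _ _) h1.le
    · rintro y ⟨hy, z, hz, rfl⟩
      exact ⟨z, hy, rfl⟩
  rw [h2] at h1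
  have h3 := (covBy_sup_of_inf_covBy_right h1).le_socleAbove
  rw [← loewy_add_one] at h3
  refine hQ.lt.not_ge ?_
  rw [hn (n + 1) (Nat.le_succ n)]
  intro z hz
  have h4 := h3 (Submodule.mem_sup_right ⟨z, hz, rfl⟩)
  exact_mod_cast h4

theorem pow_smul_eq_zero {f : A} (hf : ∀ x ∈ socle A C, P.ev f x = 0) (n : ℕ) :
    ∀ x ∈ loewy A C n, f ^ n • x = 0 := by
  induction n with
  | zero => intro x hx; simpa [loewy_zero] using hx
  | succ n ih =>
    intro x hx
    rw [Nat.cast_succ, loewy_add_one] at hx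
    rw [pow_succ, mul_smul]
    exact ih _ (P.smul_mem_of_mem_socleAbove hf hx)

/-- `f` is locally nilpotent on `C`, so `1 - f` acts injectively. Any `K`-linear left inverse,
composed with the counit, is a functional and hence an element `g` of `A`. -/
theorem exists_mul_one_sub_eq_one {f : A} (hf : ∀ x ∈ socle A C, P.ev f x = 0) :
    ∃ g, g * (1 - f) = 1 := by
  let D : C →ₗ[K] C :=
    { toFun := fun x => (1 - f) • x
      map_add' := fun x y => smul_add _ x y
      map_smul' := fun k x => smul_comm (1 - f) k x }
  have hD : LinearMap.ker D = ⊥ := by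
    rw [LinearMap.ker_eq_bot']
    intro x hx
    have h1 : f • x = x := by
      have h2 : (1 - f) • x = 0 := hx
      rw [sub_smul, one_smul, sub_eq_zero] at h2
      exact h2.symm
    obtain ⟨n, hn⟩ := P.exists_mem_loewy x
    have h2 : ∀ n : ℕ, f ^ n • x = x := by
      intro n
      induction n with
      | zero => simp
      | succ n ih => rw [pow_succ, mul_smul, h1, ih]
    rw [← h2 n, P.pow_smul_eq_zero hf n x hn]
  obtain ⟨D', hD'⟩ := LinearMap.exists_leftInverse_of_injective D hD
  refine ⟨P.ev.symm (P.ev 1 ∘ₗ D'), P.ext_left fun x => ?_⟩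
  rw [← P.ev_smul, LinearEquiv.apply_symm_apply, LinearMap.comp_apply]
  exact congrArg (P.ev 1) (LinearMap.congr_fun hD' x)

/-- The radical is the annihilator of the socle. -/
theorem mem_jacobson_iff {f : A} : f ∈ Ring.jacobson A ↔ ∀ x ∈ socle A C, P.ev f x = 0 := by
  constructor
  · intro hf x hx
    rw [P.ev_eq_one_smul, jacobson_smul_socle hf hx, map_zero]
  · intro hf
    rw [Ring.jacobson_eq_sInf_isMaximal, Submodule.mem_sInf]
    intro m hm
    by_contra hfm
    have htop : m ⊔ Submodule.span A {f} = ⊤ := (Ideal.isMaximal_def.1 hm).2 _ (left_lt_sup.2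
      fun h => hfm (h (Submodule.mem_span_singleton_self f)))
    obtain ⟨y, hy, z, hz, hyz⟩ := Submodule.mem_sup.1 ((Ideal.eq_top_iff_one _).1 htop)
    obtain ⟨g, rfl⟩ := Submodule.mem_span_singleton.1 hz
    obtain ⟨g', hg'⟩ := P.exists_mul_one_sub_eq_one (f := g • f) fun x hx => by
      rw [smul_eq_mul, ← P.ev_smul, P.smul_eq_zero_of_ev_eq_zero hf hx, map_zero]
    rw [← hyz, add_sub_cancel_right] at hg'
    refine hm.ne_top ((Ideal.eq_top_iff_one _).2 ?_)
    rw [← hyz, ← hg']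
    exact m.smul_mem g' hy

/-! ### The Loewy series of the bimodule and powers of the radical -/

omit P in
theorem _root_.jacobson_pow_smul_loewy (n : ℕ) :
    ∀ a ∈ Ring.jacobson A ^ n, ∀ x ∈ loewy A C n, a • x = 0 := by
  induction n with
  | zero => intro a _ x hx; rw [Nat.cast_zero, loewy_zero, Submodule.mem_bot] at hx; simp [hx]
  | succ n ih =>
    intro a ha x hx
    rw [Nat.cast_succ, loewy_add_one] at hx
    rw [Submodule.pow_succ] at ha
    induction ha using Submodule.mul_induction_on' with
    | mem_mul_mem y hy z hz => rw [mul_smul]; exact ih y hy _ (jacobson_smul_socleAbove hz hx)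
    | add y _ z _ h1 h2 => rw [add_smul, h1, h2, add_zero]

theorem eq_zero_of_forall_smul {a : A} (h : ∀ x : C, a • x = 0) : a = 0 :=
  P.ext_left fun x => by rw [P.ev_eq_one_smul, h]; simp

theorem eq_zero_of_mem_jacobson_pow {a : A} (h : ∀ n, a ∈ Ring.jacobson A ^ n) : a = 0 := by
  refine P.eq_zero_of_forall_smul fun x => ?_
  obtain ⟨n, hn⟩ := P.exists_mem_loewy x
  exact jacobson_pow_smul_loewy n a (h n) x hn

theorem mem_socle_of_jacobson_smul {y : C} (h : ∀ b ∈ Ring.jacobson A, b • y = 0) :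
    y ∈ socle A C := by
  by_contra hcon
  obtain ⟨f, hf, hne⟩ := P.exists_ev_ne_zero hcon
  exact hne (by rw [P.ev_eq_one_smul, h f (P.mem_jacobson_iff.2 hf), map_zero])

theorem mem_socleAbove_of_jacobson_smul {N : Submodule A C} {x : C}
    (h : ∀ b ∈ Ring.jacobson A, b • x ∈ N) : x ∈ socleAbove N := by
  let Q := (Submodule.span A {x}).map N.mkQ
  have hfd : FiniteDimensional K (Submodule.span A {x}) := P.finiteDimensional_span_singleton x
  have hart0 : IsArtinian A (Submodule.span A {x}) := isArtinian_of_tower K inferInstance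
  have hart : IsArtinian A Q := isArtinian_of_surjective _ (N.mkQ.submoduleMap (Submodule.span A {x}))
    (N.mkQ.submoduleMap_surjective _)
  -- `Q` is artinian, so its radical must be shown to vanish. A nonzero radical element would be
  -- detected by a map `θ` that sends `Q` into the socle, but maps to semisimple modules kill the
  -- radical.
  have hss : IsSemisimpleModule A Q := by
    rw [IsArtinian.isSemisimpleModule_iff_jacobson, eq_bot_iff]
    rintro ⟨_, c, hc, rfl⟩ hj
    rw [Submodule.mem_bot, ← Subtype.coe_inj]
    change N.mkQ c = 0
    rw [Submodule.mkQ_apply, Submodule.Quotient.mk_eq_zero]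
    by_contra hcN
    obtain ⟨φ, hφ, hne⟩ := P.exists_ev_ne_zero hcN
    refine hne ?_
    let θ : (C ⧸ N) →ₗ[A] C := N.liftQ (P.ract φ) fun u hu => P.ract_apply_eq_zero hφ hu
    have hθ : ∀ q : Q, (θ ∘ₗ Q.subtype) q ∈ socle A C := by
      rintro ⟨_, c, hc, rfl⟩
      refine P.mem_socle_of_jacobson_smul fun b hb => ?_
      obtain ⟨a, rfl⟩ := Submodule.mem_span_singleton.1 hc
      change b • P.ract φ (a • x) = 0
      rw [← map_smul, smul_smul]
      exact P.ract_apply_eq_zero hφ (h _ (Ideal.mul_mem_right _ _ hb))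
    have h1 := IsSemisimpleModule.jacobson_le_ker _ _ _ _ ((θ ∘ₗ Q.subtype).codRestrict _ hθ) hj
    have h2 : P.ract φ c = 0 := congrArg Subtype.val (LinearMap.mem_ker.1 h1)
    rw [← mul_one φ, ← P.ev_ract, h2, map_zero]
  exact Submodule.le_socle Q ⟨x, Submodule.mem_span_singleton_self x, rfl⟩

theorem mem_loewy_of_jacobson_pow_smul (n : ℕ) :
    ∀ x : C, (∀ a ∈ Ring.jacobson A ^ n, a • x = 0) → x ∈ loewy A C n := by
  induction n with
  | zero =>
    intro x hx
    have : x = 0 := by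
      simpa using hx 1 (by rw [Submodule.pow_zero, Ideal.one_eq_top]; trivial)
    rw [this]; exact zero_mem _
  | succ n ih =>
    intro x hx
    rw [Nat.cast_succ, loewy_add_one]
    refine P.mem_socleAbove_of_jacobson_smul fun b hb => ih _ fun a ha => ?_
    rw [smul_smul]
    refine hx _ ?_
    rw [Submodule.pow_succ]
    exact Ideal.mul_mem_mul ha hb

theorem exists_loewy_eq_top_iff :
    (∃ n : ℕ, loewy A C (n + 1 : ℕ) = ⊤) ↔ IsNilpotent (Ring.jacobson A) := by
  constructor
  · rintro ⟨n, hn⟩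
    refine ⟨n + 1, eq_bot_iff.2 fun a ha => (Submodule.mem_bot A).2 ?_⟩
    exact P.eq_zero_of_forall_smul fun x =>
      jacobson_pow_smul_loewy (n + 1) a ha x (by rw [hn]; trivial)
  · rintro ⟨n, hn⟩
    refine ⟨n, eq_top_iff.2 fun x _ => P.mem_loewy_of_jacobson_pow_smul _ x fun a ha => ?_⟩
    -- The Loewy index is shifted by one, so `J ^ n = 0` is used through `J ^ (n + 1) ≤ J ^ n`.
    have : a ∈ Ring.jacobson A ^ n := Ideal.pow_le_pow_right (Nat.le_succ n) ha
    rw [hn] at this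
    rw [(Submodule.mem_bot A).1 this, zero_smul]

/-- `y * x * z = 0` says that the functional `x` vanishes on all `P.ract y (z • c)`; let `W k` be
the span of these over `S k`. If uniformity fails, no `W k` lies in the socle, so one functional
vanishes on the socle, hence is in the radical, but on no `W k`. -/
theorem jacobsonUniform : JacobsonUniform A := by
  intro S hS h
  by_contra! hcon
  let W : ℕ → Submodule K C := fun k =>
    Submodule.span K {w | ∃ p ∈ S k, ∃ c, w = P.ract p.1 (p.2 • c)}
  have key : ∀ (y x z : A) (c : C), P.ev x (P.ract y (z • c)) = P.ev (y * x * z) c := by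
    intro y x z c
    rw [P.ev_ract, P.ev_smul]
  obtain ⟨ψ, h1, h2⟩ := exists_dual_ne_zero_of_antitone_of_not_le (W := W)
    (fun k l hkl => Submodule.span_mono fun w ⟨p, hp, hc⟩ => ⟨p, hS hkl hp, hc⟩)
    ((socle A C).restrictScalars K) (by
      intro k hle
      obtain ⟨x, hx, p, hp, hne⟩ := hcon k
      refine hne (P.ext_left fun c => ?_)
      rw [← key, map_zero, P.mem_jacobson_iff.1 hx _ (hle (Submodule.subset_span ⟨p, hp, c, rfl⟩))]
      rfl)
  obtain ⟨k, hk⟩ := h (P.ev.symm ψ) (P.mem_jacobson_iff.2 (by simpa using h1))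
  obtain ⟨w, hw, hne⟩ := h2 k
  refine hne ?_
  have : W k ≤ LinearMap.ker ψ := by
    rw [Submodule.span_le]
    rintro _ ⟨p, hp, c, rfl⟩
    have h3 := key p.1 (P.ev.symm ψ) p.2 c
    rw [hk p hp, LinearEquiv.apply_symm_apply, map_zero] at h3
    exact h3
  exact this hw

/-! ### The socle and its isotypic components -/

theorem finiteDimensional_socle_iff :
    FiniteDimensional K ((socle A C).restrictScalars K) ↔
      FiniteDimensional K (A ⧸ Ring.jacobson A) := by
  let W := (socle A C).restrictScalars K
  let ρ : A →ₗ[K] (W →ₗ[K] K) := LinearMap.lcomp K K W.subtype ∘ₗ P.ev.toLinearMap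
  have hρ : Function.Surjective ρ := by
    intro ψ
    obtain ⟨ψ', h⟩ := LinearMap.exists_extend ψ
    exact ⟨P.ev.symm ψ', by rw [← h]; ext; simp [ρ]⟩
  have hker : LinearMap.ker ρ = (Ring.jacobson A).restrictScalars K := by
    ext f
    rw [LinearMap.mem_ker, Submodule.restrictScalars_mem, P.mem_jacobson_iff]
    exact ⟨fun h x hx => LinearMap.congr_fun h ⟨x, hx⟩, fun h => LinearMap.ext fun x => h x.1 x.2⟩
  let e : (A ⧸ Ring.jacobson A) ≃ₗ[K] Module.Dual K W :=
    (Submodule.Quotient.restrictScalarsEquiv K (Ring.jacobson A)).symm ≪≫ₗ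
      Submodule.quotEquivOfEq _ _ hker.symm ≪≫ₗ ρ.quotKerEquivOfSurjective hρ
  rw [FiniteDimensional, FiniteDimensional, Module.Finite.equiv_iff e]
  exact (Module.finite_dual_iff K).symm

theorem finiteDimensional_of_isSimpleModule (S : Submodule A C) [IsSimpleModule A S] :
    FiniteDimensional K S := by
  have := IsSimpleModule.nontrivial A S
  obtain ⟨x, hx⟩ := exists_ne (0 : S)
  have h1 : S ≤ Submodule.span A {x.1} := by
    intro y hy
    have : (⟨y, hy⟩ : S) ∈ Submodule.span A {x} := by
      rw [IsSimpleModule.span_singleton_eq_top A hx]; trivial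
    obtain ⟨a, ha⟩ := Submodule.mem_span_singleton.1 this
    exact Submodule.mem_span_singleton.2 ⟨a, congrArg Subtype.val ha⟩
  have := P.finiteDimensional_span_singleton x.1
  exact Submodule.finiteDimensional_of_le (S₁ := S.restrictScalars K)
    (S₂ := (Submodule.span A {x.1}).restrictScalars K) h1

/-- Composition with the counit embeds `Hom_A(S, C)` into the finite-dimensional dual of `S`, and
the component lies in the image of `Hom_A(S, C) ⊗ S`. -/
theorem finiteDimensional_isotypicComponent (S : Submodule A C) [IsSimpleModule A S] :
    FiniteDimensional K ((isotypicComponent A C S).restrictScalars K) := by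
  have hS := P.finiteDimensional_of_isSimpleModule S
  let ι : (S →ₗ[A] C) →ₗ[K] (S →ₗ[K] K) :=
    { toFun := fun φ => P.ev 1 ∘ₗ φ.restrictScalars K
      map_add' := fun φ ψ => by ext; simp
      map_smul' := fun k φ => by ext; simp }
  have hι : Function.Injective ι := by
    rw [← LinearMap.ker_eq_bot, LinearMap.ker_eq_bot']
    intro φ hφ
    ext s
    refine P.ext_dual fun f => ?_
    rw [P.ev_eq_one_smul, ← map_smul]
    exact (LinearMap.congr_fun hφ (f • s)).trans (by simp)
  have hfin : Module.Finite K (S →ₗ[A] C) := Module.Finite.of_injective ι hι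
  let β : (S →ₗ[A] C) ⊗[K] S →ₗ[K] C :=
    TensorProduct.lift (LinearMap.restrictScalarsₗ K A S C K)
  refine Submodule.finiteDimensional_of_le (S₂ := LinearMap.range β) fun x hx => ?_
  rw [Submodule.restrictScalars_mem, isotypicComponent, sSup_eq_iSup'] at hx
  induction hx using Submodule.iSup_induction' with
  | mem m x hx =>
    obtain ⟨m, ⟨e⟩⟩ := m
    exact ⟨(m.subtype ∘ₗ e.symm.toLinearMap) ⊗ₜ e ⟨x, hx⟩, by simp [β]⟩
  | zero => exact zero_mem _
  | add x y _ _ h1 h2 => exact add_mem h1 h2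

theorem infinite_isotypicComponents (h : ¬ FiniteDimensional K (A ⧸ Ring.jacobson A)) :
    Infinite (isotypicComponents A C) := by
  rw [← P.finiteDimensional_socle_iff] at h
  by_contra hfin
  rw [not_infinite_iff_finite] at hfin
  have (c : isotypicComponents A C) : FiniteDimensional K (c.1.restrictScalars K) := by
    obtain ⟨_, S, hS, rfl⟩ := c
    exact P.finiteDimensional_isotypicComponent S
  refine h (Submodule.finiteDimensional_of_le
    (S₂ := ⨆ c : isotypicComponents A C, c.1.restrictScalars K) fun x hx => ?_)
  rw [Submodule.restrictScalars_mem, socle, sSup_eq_iSup'] at hx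
  induction hx using Submodule.iSup_induction' with
  | mem m x hx =>
    obtain ⟨m, hm⟩ := m
    exact Submodule.mem_iSup_of_mem (⟨isotypicComponent A C m, m, hm, rfl⟩ : isotypicComponents A C)
      (m.le_isotypicComponent hx)
  | zero => exact zero_mem _
  | add x y _ _ h1 h2 => exact add_mem h1 h2

theorem hasSeparatedSimples (h : ¬ FiniteDimensional K (A ⧸ Ring.jacobson A)) :
    HasSeparatedSimples A := by
  have := P.infinite_isotypicComponents h
  let c := Infinite.natEmbedding (isotypicComponents A C)
  have hrep : ∀ i, ∃ S : Submodule A C, IsSimpleModule A S ∧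
      (c i).1 = isotypicComponent A C S := fun i => (c i).2
  choose S hSs hS using hrep
  choose x hx using fun i => have := IsSimpleModule.nontrivial A (S i); exists_ne (0 : S i)
  refine ⟨fun i => LinearMap.ker (LinearMap.toSpanSingleton A (S i) (x i)),
    fun i => IsSimpleModule.ker_toSpanSingleton_isMaximal A (hx i), fun T => ?_⟩
  have hindep : iSupIndep fun i => (c i).1 :=
    ((sSupIndep_iff _).1 (sSupIndep_isotypicComponents A C)).comp c.injective
  have hdisj : Disjoint (⨆ i ∈ T, (c i).1) (⨆ i ∈ Tᶜ, (c i).1) :=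
    hindep.disjoint_biSup_biSup disjoint_compl_right
  set U := ⨆ i ∈ T, (c i).1
  set V := ⨆ i ∈ Tᶜ, (c i).1
  have hdisj' : Disjoint (U.restrictScalars K) (V.restrictScalars K) :=
    Submodule.disjoint_def.2 fun x h1 h2 => Submodule.disjoint_def.1 hdisj x h1 h2
  obtain ⟨V', hV', hcompl⟩ := hdisj'.exists_isCompl
  -- The separating element is the functional equal to the counit on `U` and zero on `V`. Isotypic
  -- components are stable under the right action, so it acts on the left as the identity on the
  -- components in `U` and as zero on those in `V`.
  let ψ : C →ₗ[K] K := P.ev 1 ∘ₗ Submodule.subtype _ ∘ₗ Submodule.projectionOnto _ _ hcompl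
  have hψU : ∀ u ∈ U, ψ u = P.ev 1 u := fun u hu => by
    have := Submodule.projectionOnto_apply_left hcompl ⟨u, hV' hu⟩
    exact congrArg (fun v : V' => P.ev 1 v.1) this
  have hψV : ∀ u ∈ V, ψ u = 0 := fun u hu => by
    have := Submodule.projectionOnto_apply_right hcompl ⟨u, hu⟩
    exact (congrArg (fun v : V' => P.ev 1 v.1) this).trans (map_zero _)
  have hinv : ∀ i f u, u ∈ (c i).1 → P.ract f u ∈ (c i).1 := fun i f u hu =>
    Submodule.IsFullyInvariant.of_mem_isotypicComponents (c i).2 (P.ract f) hu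
  have hone : ∀ i ∈ T, ∀ u ∈ (c i).1, P.ev.symm ψ • u = u := fun i hi u hu => by
    refine P.ext_dual fun f => ?_
    rw [P.ev_smul, ← P.ev_ract, LinearEquiv.apply_symm_apply,
      hψU _ (Submodule.mem_iSup_of_mem i (Submodule.mem_iSup_of_mem hi (hinv i f u hu))),
      P.ev_ract, mul_one]
  have hzero : ∀ i ∉ T, ∀ u ∈ (c i).1, P.ev.symm ψ • u = 0 := fun i hi u hu => by
    refine P.ext_dual fun f => ?_
    rw [P.ev_smul, ← P.ev_ract, LinearEquiv.apply_symm_apply,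
      hψV _ (Submodule.mem_iSup_of_mem i (Submodule.mem_iSup_of_mem hi (hinv i f u hu))), map_zero]
  have hxc : ∀ i (a : A), (a • x i : S i).1 ∈ (c i).1 := fun i a => by
    rw [hS i]; exact (S i).le_isotypicComponent (a • x i).2
  refine ⟨P.ev.symm ψ, fun i a => ⟨fun hi => ?_, fun hi => ?_⟩⟩
  · rw [LinearMap.mem_ker, LinearMap.toSpanSingleton_apply, sub_smul, mul_smul, sub_eq_zero]
    exact Subtype.ext (hone i hi _ (hxc i a))
  · rw [LinearMap.mem_ker, LinearMap.toSpanSingleton_apply, mul_smul]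
    exact Subtype.ext (hzero i hi _ (hxc i a))

end RegularPairing

/-! ### Profinite algebras are dual algebras of coalgebras -/

section Separation

variable {K V W X Y : Type*} [Field K]

section

variable [AddCommMonoid V] [Module K V] [AddCommMonoid W] [Module K W]

/-- The functional `v ⊗ w ↦ f v * g w` on a tensor product. -/
def tensorPairing (f : V →ₗ[K] K) (g : W →ₗ[K] K) : V ⊗[K] W →ₗ[K] K :=
  LinearMap.mul' K K ∘ₗ TensorProduct.map f g

@[simp]
theorem tensorPairing_tmul (f : V →ₗ[K] K) (g : W →ₗ[K] K) (v : V) (w : W) :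
    tensorPairing f g (v ⊗ₜ w) = f v * g w := by
  simp [tensorPairing]

end

variable [AddCommGroup V] [Module K V] [AddCommGroup W] [Module K W]

/-- Contracting `t` with `f x` gives a vector of `W` killed by all `g y`, hence zero. So each
coordinate of `t` in a basis of `W` is killed by all `f x`. -/
theorem eq_zero_of_tensorPairing {f : X → V →ₗ[K] K} {g : Y → W →ₗ[K] K}
    (hf : ∀ v, (∀ x, f x v = 0) → v = 0) (hg : ∀ w, (∀ y, g y w = 0) → w = 0) {t : V ⊗[K] W}
    (h : ∀ x y, tensorPairing (f x) (g y) t = 0) : t = 0 := by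
  classical
  let b := Module.Basis.ofVectorSpace K W
  let e := TensorProduct.equivFinsuppOfBasisRight (M := V) b
  rw [← e.map_eq_zero_iff]
  ext i
  refine hf _ fun x => ?_
  have h1 : ∀ y, g y (TensorProduct.lid K W ((f x).rTensor W t)) =
      tensorPairing (f x) (g y) t := by
    intro y
    clear h
    induction t with
    | zero => simp
    | add t₁ t₂ h₁ h₂ => simp only [map_add, h₁, h₂]
    | tmul v w => simp
  have h2 : f x (e t i) = b.repr (TensorProduct.lid K W ((f x).rTensor W t)) i := by
    clear h h1
    induction t with
    | zero => simp
    | add t₁ t₂ h₁ h₂ => simp only [map_add, Finsupp.add_apply, h₁, h₂]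
    | tmul v w => simp [e, mul_comm]
  rw [h2, hg _ fun y => (h1 y).trans (h x y)]; simp

theorem eq_of_tensorPairing {f : X → V →ₗ[K] K} {g : Y → W →ₗ[K] K}
    (hf : ∀ v, (∀ x, f x v = 0) → v = 0) (hg : ∀ w, (∀ y, g y w = 0) → w = 0) {s t : V ⊗[K] W}
    (h : ∀ x y, tensorPairing (f x) (g y) s = tensorPairing (f x) (g y) t) : s = t := by
  rw [← sub_eq_zero]
  exact eq_zero_of_tensorPairing hf hg fun x y => by rw [map_sub, h, sub_self]

end Separation

/-- A directed family of two-sided ideals of finite codimension in a `K`-algebra `A` such that `A`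
is the limit of the quotients. -/
structure CofiniteSystem (K A ι : Type*) [Field K] [Ring A] [Algebra K A] [Preorder ι]
    [IsDirectedOrder ι] [Nonempty ι] where
  /-- The ideals. -/
  ker : ι → Submodule K A
  anti : Antitone ker
  mul_left : ∀ i (x : A), ∀ a ∈ ker i, x * a ∈ ker i
  mul_right : ∀ i (x : A), ∀ a ∈ ker i, a * x ∈ ker i
  finite : ∀ i, FiniteDimensional K (A ⧸ ker i)
  separated : ∀ a, (∀ i, a ∈ ker i) → a = 0
  complete : ∀ b : ι → A, (∀ i j, i ≤ j → b j - b i ∈ ker i) → ∃ a, ∀ i, a - b i ∈ ker i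

/-! ### The continuous dual as a coalgebra -/

namespace CofiniteSystem

variable {K A ι : Type*} [Field K] [Ring A] [Algebra K A] [Preorder ι]
    [IsDirectedOrder ι] [Nonempty ι] (F : CofiniteSystem K A ι)

/-- The continuous functionals: those that vanish on one of the ideals. -/
def contDual : Submodule K (A →ₗ[K] K) where
  carrier := {φ | ∃ i, ∀ a ∈ F.ker i, φ a = 0}
  zero_mem' := ⟨Classical.arbitrary ι, fun _ _ => rfl⟩
  add_mem' := by
    rintro φ ψ ⟨i, hi⟩ ⟨j, hj⟩
    obtain ⟨k, hik, hjk⟩ := exists_ge_ge i j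
    refine ⟨k, fun a ha => ?_⟩
    rw [LinearMap.add_apply, hi a (F.anti hik ha), hj a (F.anti hjk ha), add_zero]
  smul_mem' := by
    rintro c φ ⟨i, hi⟩
    exact ⟨i, fun a ha => by rw [LinearMap.smul_apply, hi a ha, smul_zero]⟩

/-- The continuous dual of `A`, as a type. -/
def ContDual : Type _ := F.contDual

instance : AddCommGroup F.ContDual := inferInstanceAs (AddCommGroup F.contDual)

instance : Module K F.ContDual := inferInstanceAs (Module K F.contDual)

/-- Evaluation of continuous functionals. -/
def eval : A →ₗ[K] F.ContDual →ₗ[K] K :=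
  LinearMap.flip F.contDual.subtype

/-- The continuous functional given by a functional that vanishes on one of the ideals. -/
def ofVanishing (φ : A →ₗ[K] K) (i : ι) (h : ∀ a ∈ F.ker i, φ a = 0) : F.ContDual := ⟨φ, i, h⟩

@[simp]
theorem eval_ofVanishing (a : A) (φ : A →ₗ[K] K) (i : ι) (h : ∀ a ∈ F.ker i, φ a = 0) :
    F.eval a (F.ofVanishing φ i h) = φ a := rfl

theorem eval_separating (φ : F.ContDual) (h : ∀ a, F.eval a φ = 0) : φ = 0 :=
  Subtype.ext (LinearMap.ext h)

theorem ext_eval {φ ψ : F.ContDual} (h : ∀ a, F.eval a φ = F.eval a ψ) : φ = ψ :=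
  Subtype.ext (LinearMap.ext h)

theorem exists_eq_ofVanishing (φ : F.ContDual) : ∃ ψ i h, φ = F.ofVanishing ψ i h := by
  obtain ⟨ψ, i, h⟩ := φ
  exact ⟨ψ, i, h, rfl⟩

theorem exists_comul (φ : F.ContDual) : ∃ t : F.ContDual ⊗[K] F.ContDual,
    ∀ x y, tensorPairing (F.eval x) (F.eval y) t = F.eval (x * y) φ := by
  obtain ⟨φ, i, hi, rfl⟩ := F.exists_eq_ofVanishing φ
  have := F.finite i
  let b := Module.finBasis K (A ⧸ F.ker i)
  choose a ha using fun j => (F.ker i).mkQ_surjective (b j)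
  let coord : ∀ j, F.ContDual := fun j => F.ofVanishing (b.coord j ∘ₗ (F.ker i).mkQ) i fun c hc => by
    rw [LinearMap.comp_apply, Submodule.mkQ_apply, (Submodule.Quotient.mk_eq_zero _).2 hc, map_zero]
  let shift : ∀ j, F.ContDual := fun j => F.ofVanishing (φ ∘ₗ LinearMap.mulLeft K (a j)) i fun c hc => by
    rw [LinearMap.comp_apply, LinearMap.mulLeft_apply, hi _ (F.mul_left i _ c hc)]
  refine ⟨∑ j, coord j ⊗ₜ shift j, fun x y => ?_⟩
  -- Expanding `x` modulo the ideal in the basis lifts `a j` gives `φ (x * y) = ∑ coord j x * φ (a j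
  -- * y)`.
  have h1 : x - ∑ j, F.eval x (coord j) • a j ∈ F.ker i := by
    rw [← Submodule.Quotient.mk_eq_zero, ← Submodule.mkQ_apply, map_sub, map_sum, sub_eq_zero]
    simp only [map_smul, ha]
    exact (b.sum_repr _).symm
  have h2 := hi _ (F.mul_right i y _ h1)
  rw [sub_mul, map_sub, sub_eq_zero, Finset.sum_mul, map_sum] at h2
  change _ = φ (x * y)
  rw [h2, map_sum]
  simp [shift]

theorem tensor_ext {s t : F.ContDual ⊗[K] F.ContDual} (h : ∀ x y,
    tensorPairing (F.eval x) (F.eval y) s = tensorPairing (F.eval x) (F.eval y) t) : s = t :=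
  eq_of_tensorPairing (f := fun x => F.eval x) (g := fun x => F.eval x)
    F.eval_separating F.eval_separating h

theorem tensor_ext₃ {s t : F.ContDual ⊗[K] (F.ContDual ⊗[K] F.ContDual)} (h : ∀ x y z,
    tensorPairing (F.eval x) (tensorPairing (F.eval y) (F.eval z)) s =
      tensorPairing (F.eval x) (tensorPairing (F.eval y) (F.eval z)) t) : s = t :=
  eq_of_tensorPairing (f := fun x => F.eval x)
    (g := fun p : A × A => tensorPairing (F.eval p.1) (F.eval p.2)) F.eval_separating
    (fun _ hw => eq_zero_of_tensorPairing (f := fun x => F.eval x) (g := fun x => F.eval x)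
      F.eval_separating F.eval_separating fun y z => hw (y, z))
    fun x p => h x p.1 p.2

/-- The transpose of the multiplication. -/
noncomputable def comul : F.ContDual →ₗ[K] F.ContDual ⊗[K] F.ContDual where
  toFun φ := (F.exists_comul φ).choose
  map_add' φ ψ := F.tensor_ext fun x y => by
    rw [map_add, (F.exists_comul _).choose_spec, (F.exists_comul _).choose_spec,
      (F.exists_comul _).choose_spec]; rfl
  map_smul' c φ := F.tensor_ext fun x y => by
    rw [map_smul, (F.exists_comul _).choose_spec, (F.exists_comul _).choose_spec]; rfl

theorem tensorPairing_comul (φ : F.ContDual) (x y : A) :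
    tensorPairing (F.eval x) (F.eval y) (F.comul φ) = F.eval (x * y) φ :=
  (F.exists_comul φ).choose_spec x y

theorem tensorPairing_assoc_rTensor (x y z : A) (t : F.ContDual ⊗[K] F.ContDual) :
    tensorPairing (F.eval x) (tensorPairing (F.eval y) (F.eval z))
      (TensorProduct.assoc K _ _ _ (F.comul.rTensor _ t)) =
    tensorPairing (F.eval (x * y)) (F.eval z) t := by
  induction t with
  | zero => simp
  | add t₁ t₂ h₁ h₂ => simp only [map_add, h₁, h₂]
  | tmul α β =>
    rw [LinearMap.rTensor_tmul, tensorPairing_tmul, ← tensorPairing_comul]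
    induction F.comul α with
    | zero => simp
    | add s₁ s₂ h₁ h₂ => simp only [map_add, TensorProduct.add_tmul, h₁, h₂, add_mul]
    | tmul γ δ => simp [mul_assoc]

theorem tensorPairing_lTensor (x y z : A) (t : F.ContDual ⊗[K] F.ContDual) :
    tensorPairing (F.eval x) (tensorPairing (F.eval y) (F.eval z)) (F.comul.lTensor _ t) =
    tensorPairing (F.eval x) (F.eval (y * z)) t := by
  induction t with
  | zero => simp
  | add t₁ t₂ h₁ h₂ => simp only [map_add, h₁, h₂]
  | tmul α β => simp [tensorPairing_comul]

/-- The coalgebra structure on the continuous dual. -/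
noncomputable instance instCoalgebra : Coalgebra K F.ContDual where
  comul := F.comul
  counit := F.eval 1
  coassoc := by
    ext φ : 1
    refine F.tensor_ext₃ fun x y z => ?_
    exact (F.tensorPairing_assoc_rTensor _ _ _ _).trans (((F.tensorPairing_comul _ _ _).trans
      ((congrArg (fun a => F.eval a φ) (mul_assoc _ _ _)).trans (F.tensorPairing_comul _ _ _).symm)).trans
      (F.tensorPairing_lTensor _ _ _ _).symm)
  rTensor_counit_comp_comul := by
    ext φ : 1
    apply (TensorProduct.lid K F.ContDual).injective
    refine F.ext_eval fun a => ?_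
    have h : ∀ t : F.ContDual ⊗[K] F.ContDual,
        F.eval a (TensorProduct.lid K F.ContDual ((F.eval 1).rTensor _ t)) =
          tensorPairing (F.eval 1) (F.eval a) t := by
      intro t
      induction t with
      | zero => simp
      | add t₁ t₂ h₁ h₂ =>
        simp only [map_add, h₁, h₂]
      | tmul α β => simp
    rw [LinearMap.comp_apply, h, tensorPairing_comul]
    simp
  lTensor_counit_comp_comul := by
    ext φ : 1
    apply (TensorProduct.rid K F.ContDual).injective
    refine F.ext_eval fun a => ?_
    have h : ∀ t : F.ContDual ⊗[K] F.ContDual,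
        F.eval a (TensorProduct.rid K F.ContDual ((F.eval 1).lTensor _ t)) =
          tensorPairing (F.eval a) (F.eval 1) t := by
      intro t
      induction t with
      | zero => simp
      | add t₁ t₂ h₁ h₂ =>
        simp only [map_add, h₁, h₂]
      | tmul α β => simp [mul_comm]
    rw [LinearMap.comp_apply, h, tensorPairing_comul]
    simp

/-- The canonical map to the dual algebra of the continuous dual. -/
noncomputable def toDualAlgebra : A →ₐ[K] DualAlgebra K F.ContDual :=
  AlgHom.ofLinearMap ((WithConv.linearEquiv K (F.ContDual →ₗ[K] K)).symm.toLinearMap ∘ₗ F.eval)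
    (by ext φ; simp [LinearMap.convOne_def]; rfl)
    (fun x y => by
      ext φ
      exact (F.tensorPairing_comul φ x y).symm)

theorem mem_ker_of_forall {i : ι} {a : A}
    (h : ∀ φ : A →ₗ[K] K, (∀ c ∈ F.ker i, φ c = 0) → φ a = 0) : a ∈ F.ker i := by
  by_contra hcon
  obtain ⟨φ, h1, h2⟩ := exists_dual_eq_zero_ne_zero hcon
  exact h2 (h φ h1)

theorem toDualAlgebra_injective : Function.Injective F.toDualAlgebra := by
  rw [injective_iff_map_eq_zero]
  intro a ha
  refine F.separated a fun i => F.mem_ker_of_forall fun φ hφ => ?_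
  exact LinearMap.congr_fun (congrArg WithConv.ofConv ha) (F.ofVanishing φ i hφ)

/-- On functionals vanishing on `F.ker i`, `f` is an element of the double dual of a
finite-dimensional space, hence evaluation at some `b i`. These are compatible, and completeness
supplies the limit. -/
theorem toDualAlgebra_surjective : Function.Surjective F.toDualAlgebra := by
  intro f
  have h1 : ∀ i, ∃ b : A, ∀ (φ : A →ₗ[K] K) (hφ : ∀ c ∈ F.ker i, φ c = 0),
      f.ofConv (F.ofVanishing φ i hφ) = φ b := by
    intro i
    have := F.finite i
    let G : Module.Dual K (Module.Dual K (A ⧸ F.ker i)) :=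
      { toFun := fun ψ => f.ofConv (F.ofVanishing (ψ ∘ₗ (F.ker i).mkQ) i fun c hc => by
          rw [LinearMap.comp_apply, Submodule.mkQ_apply, (Submodule.Quotient.mk_eq_zero _).2 hc,
            map_zero])
        map_add' := fun ψ ψ' => by rw [← map_add]; rfl
        map_smul' := fun c ψ => by rw [RingHom.id_apply, ← map_smul]; rfl }
    obtain ⟨b', hb'⟩ := (Module.evalEquiv K (A ⧸ F.ker i)).surjective G
    obtain ⟨b, rfl⟩ := (F.ker i).mkQ_surjective b'
    refine ⟨b, fun φ hφ => ?_⟩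
    have h2 := LinearMap.congr_fun hb' ((F.ker i).liftQ φ hφ)
    have h3 : φ b = G ((F.ker i).liftQ φ hφ) := h2
    exact (congrArg f.ofConv (F.ext_eval fun a => rfl)).trans h3.symm
  choose b hb using h1
  obtain ⟨a, ha⟩ := F.complete b fun i j hij => F.mem_ker_of_forall fun φ hφ => by
    rw [map_sub, ← hb i φ hφ, ← hb j φ fun c hc => hφ c (F.anti hij hc)]
    exact sub_eq_zero.2 rfl
  refine ⟨a, WithConv.ofConv_injective (LinearMap.ext fun φ => ?_)⟩
  obtain ⟨φ, i, hφ, rfl⟩ := F.exists_eq_ofVanishing φ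
  have h2 := hφ _ (ha i)
  rw [map_sub, sub_eq_zero] at h2
  exact h2.trans (hb i φ hφ).symm

end CofiniteSystem

theorem IsProfiniteAlgebra.exists_coalgebra.{x, y, u, v} {K : Type u} [Field K] {A : Type v}
    [Ring A] [Algebra K A] (h : IsProfiniteAlgebra.{x, y} K A) :
    ∃ (C : Type (max u v)) (_ : AddCommGroup C) (_ : Module K C) (_ : Coalgebra K C),
      Nonempty (A ≃ₐ[K] DualAlgebra K C) := by
  obtain ⟨ι, _, _, B, _, _, _, f, π, hid, hcomp, hπ, hlim⟩ := h
  suffices hF : ∃ (ι : Type x) (_ : Preorder ι) (_ : IsDirectedOrder ι) (_ : Nonempty ι),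
      Nonempty (CofiniteSystem K A ι) by
    obtain ⟨ι, _, _, _, ⟨F⟩⟩ := hF
    exact ⟨F.ContDual, inferInstance, inferInstance, inferInstance,
      ⟨AlgEquiv.ofBijective F.toDualAlgebra ⟨F.toDualAlgebra_injective, F.toDualAlgebra_surjective⟩⟩⟩
  have hsep : ∀ a, (∀ i, π i a = 0) → a = 0 := fun a ha => by
    obtain ⟨c, -, hc⟩ := hlim (fun _ => 0) fun i j hij => map_zero _
    rw [hc a ha, hc 0 fun i => map_zero _]
  -- An empty system has limit zero; a one-point index set then replaces it.
  rcases isEmpty_or_nonempty ι with hι | hι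
  · have : Subsingleton A := ⟨fun a b => by
      rw [← sub_eq_zero]; exact hsep _ fun i => isEmptyElim i⟩
    exact ⟨PUnit, inferInstance, inferInstance, inferInstance, ⟨{
      ker := fun _ => ⊥
      anti := fun _ _ _ => le_rfl
      mul_left := fun _ _ _ _ => (Submodule.mem_bot K).2 (Subsingleton.elim _ _)
      mul_right := fun _ _ _ _ => (Submodule.mem_bot K).2 (Subsingleton.elim _ _)
      finite := fun _ => inferInstance
      separated := fun _ _ => Subsingleton.elim _ _
      complete := fun _ _ => ⟨0, fun _ => (Submodule.mem_bot K).2 (Subsingleton.elim _ _)⟩ }⟩⟩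
  · refine ⟨ι, inferInstance, inferInstance, hι, ⟨{
      ker := fun i => LinearMap.ker (π i).toLinearMap
      anti := ?_
      mul_left := ?_
      mul_right := ?_
      finite := ?_
      separated := hsep
      complete := ?_ }⟩⟩
    · intro i j hij a ha
      rw [LinearMap.mem_ker, AlgHom.toLinearMap_apply] at ha ⊢
      rw [← hπ i j hij, AlgHom.comp_apply, ha, map_zero]
    · intro i x a ha
      rw [LinearMap.mem_ker, AlgHom.toLinearMap_apply] at ha ⊢
      rw [map_mul, ha, mul_zero]
    · intro i x a ha
      rw [LinearMap.mem_ker, AlgHom.toLinearMap_apply] at ha ⊢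
      rw [map_mul, ha, zero_mul]
    · intro i
      exact Module.Finite.equiv (π i).toLinearMap.quotKerEquivRange.symm
    · intro b hb
      obtain ⟨a, ha, -⟩ := hlim (fun i => π i (b i)) fun i j hij => by
        have h1 : π i (b j - b i) = 0 := hb i j hij
        rw [map_sub, sub_eq_zero] at h1
        rw [← h1, ← hπ i j hij, AlgHom.comp_apply]
      refine ⟨a, fun i => ?_⟩
      rw [LinearMap.mem_ker, AlgHom.toLinearMap_apply, map_sub, ha, sub_self]

/-! ### Invariance of the radical under isomorphisms and opposites -/

section Transport

variable {A B : Type*} [Ring A] [Ring B]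

theorem Ring.mem_jacobson_iff_exists {x : A} :
    x ∈ Ring.jacobson A ↔ ∀ y, ∃ z, z * (1 + y * x) = 1 := by
  rw [← Ideal.jacobson_bot, Ideal.mem_jacobson_iff]
  refine forall_congr' fun y => exists_congr fun z => ?_
  rw [Submodule.mem_bot, sub_eq_zero, mul_add, mul_one, mul_assoc, add_comm]

theorem RingEquiv.mem_jacobson_iff (e : A ≃+* B) {x : A} :
    e x ∈ Ring.jacobson B ↔ x ∈ Ring.jacobson A := by
  rw [Ring.mem_jacobson_iff_exists, Ring.mem_jacobson_iff_exists, ← e.toEquiv.forall_congr_right]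
  refine forall_congr' fun y => ?_
  rw [← e.toEquiv.exists_congr_right]
  refine exists_congr fun z => ?_
  rw [← e.injective.eq_iff]
  simp

/-- With `u` in the radical, a left inverse `z` of `1 + u` equals `1 - z * u`, so it has a left
inverse too and is a two-sided inverse of `1 + u`. -/
theorem MulOpposite.op_mem_jacobson {x : A} (hx : x ∈ Ring.jacobson A) :
    MulOpposite.op x ∈ Ring.jacobson Aᵐᵒᵖ := by
  rw [Ring.mem_jacobson_iff_exists]
  intro y
  have hu : x * y.unop ∈ Ring.jacobson A := Ideal.mul_mem_right _ _ hx
  obtain ⟨z, hz⟩ := Ring.mem_jacobson_iff_exists.1 hu 1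
  obtain ⟨w, hw⟩ := Ring.mem_jacobson_iff_exists.1 hu (-z)
  rw [one_mul] at hz
  have h1 : 1 + -z * (x * y.unop) = z := by
    nth_rw 1 [← hz]
    rw [mul_add, mul_one, neg_mul, add_neg_cancel_right]
  rw [h1] at hw
  have h2 : w = 1 + x * y.unop := left_inv_eq_right_inv hw hz
  rw [h2] at hw
  exact ⟨MulOpposite.op z, MulOpposite.unop_injective (by simpa using hw)⟩

theorem MulOpposite.op_mem_jacobson_iff {x : A} :
    MulOpposite.op x ∈ Ring.jacobson Aᵐᵒᵖ ↔ x ∈ Ring.jacobson A := by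
  refine ⟨fun h => ?_, MulOpposite.op_mem_jacobson⟩
  rw [← (RingEquiv.opOp A).mem_jacobson_iff]
  exact MulOpposite.op_mem_jacobson h

/-- Vanishing of all products of `n` elements is a criterion visibly preserved by isomorphisms and
by reversal of products. -/
theorem Ideal.isNilpotent_iff_list_prod (I : Ideal A) [I.IsTwoSided] :
    IsNilpotent I ↔ ∃ n, ∀ l : List A, l.length = n → (∀ x ∈ l, x ∈ I) → l.prod = 0 := by
  refine exists_congr fun n => ⟨fun h l hl hI => ?_, fun h => ?_⟩
  · have key : ∀ l : List A, (∀ x ∈ l, x ∈ I) → l.prod ∈ I ^ l.length := by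
      intro l
      induction l with
      | nil => intro _; rw [List.length_nil, Submodule.pow_zero, Ideal.one_eq_top]; trivial
      | cons a l ih =>
        intro hI
        rw [List.prod_cons, List.length_cons, Ideal.IsTwoSided.pow_succ]
        exact Ideal.mul_mem_mul (hI a (by simp)) (ih fun x hx => hI x (by simp [hx]))
    have := key l hI
    rw [hl, h] at this
    exact (Submodule.mem_bot A).1 this
  -- Factors are moved one at a time from `I ^ k` into the list.
  · have key : ∀ k j, k + j = n → ∀ y ∈ I ^ k, ∀ l : List A, l.length = j → (∀ x ∈ l, x ∈ I) →
        l.prod * y = 0 := by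
      intro k
      induction k with
      | zero =>
        intro j hj y _ l hl hI
        rw [h l (by omega) hI, zero_mul]
      | succ k ih =>
        intro j hj y hy l hl hI
        rw [Ideal.IsTwoSided.pow_succ] at hy
        induction hy using Submodule.mul_induction_on' with
        | mem_mul_mem a ha b hb =>
          have := ih (j + 1) (by omega) b hb (l ++ [a]) (by simp [hl]) (by
            intro x hx
            rcases List.mem_append.1 hx with hx | hx
            · exact hI x hx
            · rw [List.mem_singleton.1 hx]; exact ha)
          rwa [List.prod_append, List.prod_singleton, mul_assoc] at this
        | add a _ b _ h1 h2 => rw [mul_add, h1, h2, add_zero]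
    refine eq_bot_iff.2 fun y hy => (Submodule.mem_bot A).2 ?_
    simpa using key n 0 rfl y hy [] rfl (by simp)

theorem RingEquiv.isNilpotent_jacobson_iff (e : A ≃+* B) :
    IsNilpotent (Ring.jacobson A) ↔ IsNilpotent (Ring.jacobson B) := by
  rw [Ideal.isNilpotent_iff_list_prod, Ideal.isNilpotent_iff_list_prod]
  refine exists_congr fun n => ?_
  constructor
  · intro h l hl hJ
    rw [← map_eq_zero_iff e.symm e.symm.injective, map_list_prod]
    refine h _ (by simpa using hl) fun x hx => ?_
    obtain ⟨y, hy, rfl⟩ := List.mem_map.1 hx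
    exact e.symm.mem_jacobson_iff.2 (hJ y hy)
  · intro h l hl hJ
    rw [← map_eq_zero_iff e e.injective, map_list_prod]
    refine h _ (by simpa using hl) fun x hx => ?_
    obtain ⟨y, hy, rfl⟩ := List.mem_map.1 hx
    exact e.mem_jacobson_iff.2 (hJ y hy)

theorem MulOpposite.isNilpotent_jacobson_iff :
    IsNilpotent (Ring.jacobson Aᵐᵒᵖ) ↔ IsNilpotent (Ring.jacobson A) := by
  rw [Ideal.isNilpotent_iff_list_prod, Ideal.isNilpotent_iff_list_prod]
  refine exists_congr fun n => ?_
  constructor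
  · intro h l hl hJ
    rw [← MulOpposite.op_eq_zero_iff, MulOpposite.op_list_prod]
    refine h _ (by simpa using hl) fun x hx => ?_
    obtain ⟨y, hy, rfl⟩ := List.mem_map.1 (List.mem_reverse.1 hx)
    exact MulOpposite.op_mem_jacobson (hJ y hy)
  · intro h l hl hJ
    rw [← MulOpposite.unop_eq_zero_iff, MulOpposite.unop_list_prod]
    refine h _ (by simpa using hl) fun x hx => ?_
    obtain ⟨y, hy, rfl⟩ := List.mem_map.1 (List.mem_reverse.1 hx)
    exact MulOpposite.op_mem_jacobson_iff.1 (hJ y hy)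

variable {K : Type*} [Field K] [Algebra K A] [Algebra K B]

theorem LinearEquiv.finiteDimensional_quot_jacobson_iff (e : A ≃ₗ[K] B)
    (he : ∀ x, e x ∈ Ring.jacobson B ↔ x ∈ Ring.jacobson A) :
    FiniteDimensional K (A ⧸ Ring.jacobson A) ↔ FiniteDimensional K (B ⧸ Ring.jacobson B) := by
  let f := (Submodule.Quotient.restrictScalarsEquiv K (Ring.jacobson A)).symm ≪≫ₗ
    Submodule.Quotient.equiv ((Ring.jacobson A).restrictScalars K)
      ((Ring.jacobson B).restrictScalars K) e (by
        ext y
        constructor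
        · rintro ⟨x, hx, rfl⟩
          exact (he x).2 hx
        · intro hy
          exact ⟨e.symm y, (he _).1 (by simpa using hy), by simp⟩) ≪≫ₗ
    Submodule.Quotient.restrictScalarsEquiv K (Ring.jacobson B)
  exact Module.Finite.equiv_iff f

end Transport

/-! ### The ring-theoretic conclusions for regular pairings -/

namespace RegularPairing

universe u v w z

variable {K : Type u} {A : Type v} {C : Type z} [Field K] [Ring A] [Algebra K A] [AddCommGroup C]
    [Module K C] [Module A C] [IsScalarTower K A C]

theorem finitelyManySimples_iff (P : RegularPairing K A C) :
    FinitelyManySimples.{v, w} A ↔ FiniteDimensional K (A ⧸ Ring.jacobson A) := by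
  constructor
  · intro h
    by_contra hfd
    exact h.not_hasSeparatedSimples (P.hasSeparatedSimples hfd)
  · intro h
    have : IsArtinian A (A ⧸ Ring.jacobson A) := isArtinian_of_tower K inferInstance
    exact finitelyManySimples_of_isArtinian

theorem isSemiartinian_of_finiteDimensional (hfd : FiniteDimensional K (A ⧸ Ring.jacobson A))
    (hnil : IsNilpotent (Ring.jacobson A)) : IsSemiartinian A A := by
  have : IsArtinian A (A ⧸ Ring.jacobson A) := isArtinian_of_tower K inferInstance
  exact isSemiartinian_of_isNilpotent_jacobson hnil

theorem dicksonTorsionSplits_iff (P : RegularPairing K A C) :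
    DicksonTorsionSplits.{v, w} A ↔
      FiniteDimensional K (A ⧸ Ring.jacobson A) ∧ IsNilpotent (Ring.jacobson A) := by
  constructor
  · intro h
    have hfd : FiniteDimensional K (A ⧸ Ring.jacobson A) := by
      by_contra hfd
      exact h.not_hasSeparatedSimples (P.hasSeparatedSimples hfd)
    have : IsArtinian A (A ⧸ Ring.jacobson A) := isArtinian_of_tower K inferInstance
    exact ⟨hfd, h.isNilpotent_jacobson P.jacobsonUniform fun a => P.eq_zero_of_mem_jacobson_pow⟩
  · rintro ⟨hfd, hnil⟩
    exact (isSemiartinian_of_finiteDimensional hfd hnil).dicksonTorsionSplits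

theorem isSemiartinian_iff (P : RegularPairing K A C) :
    IsSemiartinian A A ↔
      FiniteDimensional K (A ⧸ Ring.jacobson A) ∧ IsNilpotent (Ring.jacobson A) :=
  ⟨fun h => P.dicksonTorsionSplits_iff.1 (h.dicksonTorsionSplits : DicksonTorsionSplits.{v, v} A),
    fun h => isSemiartinian_of_finiteDimensional h.1 h.2⟩

/-- Transport of a pairing along an isomorphism of algebras. -/
theorem exists_congr {B : Type*} [Ring B] [Algebra K B] (P : RegularPairing K A C)
    (e : B ≃ₐ[K] A) : ∃ (_ : Module B C) (_ : IsScalarTower K B C), Nonempty (RegularPairing K B C) := by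
  let _ : Module B C := Module.compHom C (e : B →+* A)
  have hsmul : ∀ (b : B) (x : C), b • x = e b • x := fun _ _ => rfl
  have htower : IsScalarTower K B C := ⟨fun k b x => by rw [hsmul, map_smul, smul_assoc, hsmul]⟩
  exact ⟨inferInstance, htower, ⟨{
    ev := e.toLinearEquiv ≪≫ₗ P.ev
    ract := fun b =>
      { toFun := P.ract (e b)
        map_add' := map_add _
        map_smul' := fun c x => map_smul (P.ract (e b)) (e c) x }
    ev_smul := fun f g x => by simp [hsmul, P.ev_smul]
    ev_ract := fun f g x => (P.ev_ract (e f) (e g) x).trans (by simp)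
    exists_finiteDimensional := fun x => by
      obtain ⟨W, hW, h⟩ := P.exists_finiteDimensional x
      exact ⟨W, hW, fun b => h (e b)⟩ }⟩⟩

end RegularPairing

/-! ### The pairings of a coalgebra with its dual algebra -/

namespace DualAlgebra

theorem ext_ofConv {K C : Type*} [Field K] [AddCommGroup C] [Module K C] {x y : C}
    (h : ∀ f : WithConv (C →ₗ[K] K), f.ofConv x = f.ofConv y) : x = y := by
  rw [← sub_eq_zero, ← Module.forall_dual_apply_eq_zero_iff K]
  intro φ
  rw [map_sub, sub_eq_zero]
  exact h (WithConv.toConv φ)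

variable {K C : Type*} [Field K] [AddCommGroup C] [Module K C] [Coalgebra K C]

/-- The right action `x ◁ f = ∑ f x₁ x₂` of the dual algebra on a coalgebra. -/
noncomputable def rightAction (f : DualAlgebra K C) : C →ₗ[K] C :=
  (TensorProduct.lid K C).toLinearMap ∘ₗ f.ofConv.rTensor C ∘ₗ Coalgebra.comul

theorem ofConv_smul (f g : DualAlgebra K C) (x : C) : f.ofConv (g • x) = (f * g).ofConv x := by
  have h : ∀ t : C ⊗[K] C, f.ofConv (TensorProduct.rid K C (g.ofConv.lTensor C t)) =
      LinearMap.mul' K K (TensorProduct.map f.ofConv g.ofConv t) := by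
    intro t
    induction t with
    | zero => simp
    | add t₁ t₂ h₁ h₂ => simp only [map_add, h₁, h₂]
    | tmul a b => simp [mul_comm]
  exact h _

theorem ofConv_rightAction (f g : DualAlgebra K C) (x : C) :
    g.ofConv (rightAction f x) = (f * g).ofConv x := by
  have h : ∀ t : C ⊗[K] C, g.ofConv (TensorProduct.lid K C (f.ofConv.rTensor C t)) =
      LinearMap.mul' K K (TensorProduct.map f.ofConv g.ofConv t) := by
    intro t
    induction t with
    | zero => simp
    | add t₁ t₂ h₁ h₂ => simp only [map_add, h₁, h₂]
    | tmul a b => simp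
  exact h _

theorem rightAction_smul (f a : DualAlgebra K C) (x : C) :
    rightAction f (a • x) = a • rightAction f x :=
  ext_ofConv (K := K) fun g => by
    rw [ofConv_rightAction, ofConv_smul, ofConv_smul, ofConv_rightAction, mul_assoc]

theorem exists_finiteDimensional_smul (x : C) : ∃ W : Submodule K C, FiniteDimensional K W ∧
    ∀ f : DualAlgebra K C, f • x ∈ W := by
  have h : ∀ t : C ⊗[K] C, ∃ W : Submodule K C, FiniteDimensional K W ∧
      ∀ f : C →ₗ[K] K, TensorProduct.rid K C (f.lTensor C t) ∈ W := by
    intro t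
    induction t with
    | zero => exact ⟨⊥, inferInstance, fun f => by simp⟩
    | add t₁ t₂ h₁ h₂ =>
      obtain ⟨W₁, _, h₁⟩ := h₁
      obtain ⟨W₂, _, h₂⟩ := h₂
      exact ⟨W₁ ⊔ W₂, inferInstance, fun f => by
        rw [map_add, map_add]; exact Submodule.add_mem_sup (h₁ f) (h₂ f)⟩
    | tmul a b =>
      exact ⟨Submodule.span K {a}, inferInstance, fun f => by
        simpa using Submodule.smul_mem _ _ (Submodule.mem_span_singleton_self a)⟩
  obtain ⟨W, hW, h⟩ := h (Coalgebra.comul x)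
  exact ⟨W, hW, fun f => h f.ofConv⟩

theorem exists_finiteDimensional_rightAction (x : C) : ∃ W : Submodule K C, FiniteDimensional K W ∧
    ∀ f : DualAlgebra K C, rightAction f x ∈ W := by
  have h : ∀ t : C ⊗[K] C, ∃ W : Submodule K C, FiniteDimensional K W ∧
      ∀ f : C →ₗ[K] K, TensorProduct.lid K C (f.rTensor C t) ∈ W := by
    intro t
    induction t with
    | zero => exact ⟨⊥, inferInstance, fun f => by simp⟩
    | add t₁ t₂ h₁ h₂ =>
      obtain ⟨W₁, _, h₁⟩ := h₁
      obtain ⟨W₂, _, h₂⟩ := h₂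
      exact ⟨W₁ ⊔ W₂, inferInstance, fun f => by
        rw [map_add, map_add]; exact Submodule.add_mem_sup (h₁ f) (h₂ f)⟩
    | tmul a b =>
      exact ⟨Submodule.span K {b}, inferInstance, fun f => by
        simpa using Submodule.smul_mem _ _ (Submodule.mem_span_singleton_self b)⟩
  obtain ⟨W, hW, h⟩ := h (Coalgebra.comul x)
  exact ⟨W, hW, fun f => h f.ofConv⟩

variable (K C)

/-- A coalgebra is paired with its dual algebra. -/
noncomputable def regularPairing : RegularPairing K (DualAlgebra K C) C where
  ev := WithConv.linearEquiv K (C →ₗ[K] K)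
  ract f :=
    { toFun := rightAction f
      map_add' := map_add _
      map_smul' := rightAction_smul f }
  ev_smul := ofConv_smul
  ev_ract := ofConv_rightAction
  exists_finiteDimensional := exists_finiteDimensional_smul

/-- A coalgebra is paired with the opposite of its dual algebra. -/
theorem exists_regularPairing_op : ∃ (_ : Module (DualAlgebra K C)ᵐᵒᵖ C)
    (_ : IsScalarTower K (DualAlgebra K C)ᵐᵒᵖ C),
      Nonempty (RegularPairing K (DualAlgebra K C)ᵐᵒᵖ C) := by
  let _ : Module (DualAlgebra K C)ᵐᵒᵖ C :=
    { smul := fun f x => rightAction f.unop x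
      one_smul := fun x => ext_ofConv (K := K) fun g => by
        change g.ofConv (rightAction 1 x) = _
        rw [ofConv_rightAction, one_mul]
      mul_smul := fun f g x => ext_ofConv (K := K) fun h => by
        change h.ofConv (rightAction (g.unop * f.unop) x) =
          h.ofConv (rightAction f.unop (rightAction g.unop x))
        rw [ofConv_rightAction, ofConv_rightAction, ofConv_rightAction, mul_assoc]
      smul_zero := fun f => map_zero (rightAction f.unop)
      smul_add := fun f x y => map_add (rightAction f.unop) x y
      add_smul := fun f g x => ext_ofConv (K := K) fun h => by
        change h.ofConv (rightAction (f.unop + g.unop) x) =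
          h.ofConv (rightAction f.unop x + rightAction g.unop x)
        rw [map_add, ofConv_rightAction, ofConv_rightAction, ofConv_rightAction, add_mul]; rfl
      zero_smul := fun x => ext_ofConv (K := K) fun h => by
        change h.ofConv (rightAction 0 x) = _
        rw [ofConv_rightAction, zero_mul, map_zero]; rfl }
  have htower : IsScalarTower K (DualAlgebra K C)ᵐᵒᵖ C := ⟨fun k f x => ext_ofConv (K := K) fun h => by
    change h.ofConv (rightAction (k • f.unop) x) = h.ofConv (k • rightAction f.unop x)
    rw [map_smul, ofConv_rightAction, ofConv_rightAction, smul_mul_assoc]; rfl⟩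
  exact ⟨inferInstance, htower, ⟨{
    ev := (MulOpposite.opLinearEquiv K).symm ≪≫ₗ WithConv.linearEquiv K (C →ₗ[K] K)
    -- Over the opposite algebra the two actions exchange roles.
    ract := fun f =>
      { toFun := fun x => f.unop • x
        map_add' := smul_add _
        map_smul' := fun a x => (rightAction_smul a.unop f.unop x).symm }
    ev_smul := fun f g x => ofConv_rightAction g.unop f.unop x
    ev_ract := fun f g x => ofConv_smul g.unop f.unop x
    exists_finiteDimensional := fun x => by
      obtain ⟨W, hW, h⟩ := exists_finiteDimensional_rightAction (K := K) x
      exact ⟨W, hW, fun f => h f.unop⟩ }⟩⟩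

theorem coradicalFiltration_zero :
    coradicalFiltration K C 0 = (socle (DualAlgebra K C) C).restrictScalars K := by
  rw [coradicalFiltration]
  congr 1
  rw [Nat.cast_add, Nat.cast_zero, Nat.cast_one, loewy_add_one, loewy_zero, socleAbove_eq,
    bot_sup_eq, socle]
  simp only [bot_covBy_iff, isSimpleModule_iff_isAtom]

theorem coradicalFiltration_eq_top_iff (n : ℕ) :
    coradicalFiltration K C n = ⊤ ↔ loewy (DualAlgebra K C) C (n + 1 : ℕ) = ⊤ :=
  Submodule.restrictScalars_eq_top_iff K _ _

end DualAlgebra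

theorem isSemiartinian_op_iff {A : Type*} [Ring A] :
    IsSemiartinian Aᵐᵒᵖ A ↔ IsSemiartinian Aᵐᵒᵖ Aᵐᵒᵖ :=
  LinearEquiv.isSemiartinian_iff
    { toFun := MulOpposite.op
      invFun := MulOpposite.unop
      map_add' := fun _ _ => rfl
      map_smul' := fun _ _ => rfl
      left_inv := fun _ => rfl
      right_inv := fun _ => rfl }

universe x y z w u v

theorem corollary1p4 (K : Type u) [Field K] (A : Type v) [Ring A] [Algebra K A] :
    (IsProfiniteAlgebra.{x, y} K A →
      ∃ (C : Type (max u v)) (_ : AddCommGroup C) (_ : Module K C) (_ : Coalgebra K C),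
        Nonempty (A ≃ₐ[K] DualAlgebra K C)) ∧
    ∀ (C : Type z) [AddCommGroup C] [Module K C] [Coalgebra K C],
      Nonempty (A ≃ₐ[K] DualAlgebra K C) →
      [DicksonTorsionSplits.{v, w} A,
        DicksonTorsionSplits.{v, w} Aᵐᵒᵖ,
        IsSemiartinian A A,
        IsSemiartinian Aᵐᵒᵖ A,
        FiniteDimensional K (coradicalFiltration K C 0) ∧
          ∃ n : ℕ, coradicalFiltration K C n = ⊤].TFAE ∧
      (FiniteDimensional K (coradicalFiltration K C 0) ↔ FinitelyManySimples.{v, w} A) ∧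
      (FiniteDimensional K (coradicalFiltration K C 0) ↔ FinitelyManySimples.{v, w} Aᵐᵒᵖ) ∧
      ((∃ n : ℕ, coradicalFiltration K C n = ⊤) ↔ IsNilpotent (Ring.jacobson A)) := by
  refine ⟨fun h => h.exists_coalgebra, fun C _ _ _ ⟨e⟩ => ?_⟩
  have hfd : FiniteDimensional K (coradicalFiltration K C 0) ↔
      FiniteDimensional K (A ⧸ Ring.jacobson A) := by
    rw [DualAlgebra.coradicalFiltration_zero,
      (DualAlgebra.regularPairing K C).finiteDimensional_socle_iff]
    exact (e.toLinearEquiv.finiteDimensional_quot_jacobson_iff fun x =>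
      e.toRingEquiv.mem_jacobson_iff).symm
  have hnil : (∃ n : ℕ, coradicalFiltration K C n = ⊤) ↔ IsNilpotent (Ring.jacobson A) := by
    simp only [DualAlgebra.coradicalFiltration_eq_top_iff]
    rw [(DualAlgebra.regularPairing K C).exists_loewy_eq_top_iff]
    exact e.toRingEquiv.isNilpotent_jacobson_iff.symm
  have hfd_op : FiniteDimensional K (Aᵐᵒᵖ ⧸ Ring.jacobson Aᵐᵒᵖ) ↔
      FiniteDimensional K (A ⧸ Ring.jacobson A) :=
    ((MulOpposite.opLinearEquiv K).finiteDimensional_quot_jacobson_iff fun x =>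
      MulOpposite.op_mem_jacobson_iff).symm
  have hnil_op := MulOpposite.isNilpotent_jacobson_iff (A := A)
  obtain ⟨_, _, ⟨P⟩⟩ := (DualAlgebra.regularPairing K C).exists_congr e
  obtain ⟨_, _, ⟨Q₀⟩⟩ := DualAlgebra.exists_regularPairing_op K C
  obtain ⟨_, _, ⟨Q⟩⟩ := Q₀.exists_congr (AlgEquiv.op e)
  refine ⟨?_, ?_, ?_, hnil⟩
  -- All five conditions become the same conjunction on `A ⧸ J` and `J`.
  · rw [P.dicksonTorsionSplits_iff, Q.dicksonTorsionSplits_iff, P.isSemiartinian_iff,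
      isSemiartinian_op_iff, Q.isSemiartinian_iff, hfd_op, hnil_op, hfd, hnil]
    exact List.tfae_of_forall (FiniteDimensional K (A ⧸ Ring.jacobson A) ∧
      IsNilpotent (Ring.jacobson A)) _ (by simp)
  · rw [hfd, P.finitelyManySimples_iff]
  · rw [hfd, Q.finitelyManySimples_iff, hfd_op]
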